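/- Let $n_t, K \ge 1$ be integers and $P>0$. Let $\vec h=(h_1,\dots,h_{n_t})$ be a random row vector with i.i.d. $\mathcal{CN}(0,1)$ entries (circularly symmetric complex Gaussian, real and imaginary parts independent $\mathcal N(0,1/2)$), the channel vector of the $n_t\times 1$ MISO Rayleigh fading channel with unit-power noise. For positive semidefinite transmit covariance matrices $\mathbf Q_1,\dots,\mathbf Q_K\in\mathbb C^{n_t\times n_t}$ and rates $R_1,\dots,R_K\ge 0$ of the layers, let $$\mathcal I_i=\ln\left(1+\frac{\vec h\mathbf Q_i\vec h^\dagger}{1+\vec h\left(\sum_{j=i+1}^K\mathbf Q_j\right)\vec h^\dagger}\right),\qquad \mathcal R_f(\mathbf Q,R)=\sum_{i=1}^K \Pr\{\mathcal I_i\ge R_i\}\,R_i ,$$ be the instantaneous mutual information of layer $i$ and the $K$-layer expected-rate, and let $$\mathcal R_f^m=\max\Big\{\mathcal R_f(\mathbf Q,R)\;:\; R_i\ge 0,\ P_i\ge 0,\ \sum_{i=1}^K P_i=P,\ \mathbf Q_i\succeq 0,\ \operatorname{tr}(\mathbf Q_i)\le P_i\Big\}.$$ 1. The covariance matrices $\mathbf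 Q_i=\frac{P_i}{n_t}\mathbf I_{n_t}$ are optimal: for every $P_1,\dots,P_K\ge 0$ with $\sum_i P_i=P$, the maximum of $\mathcal R_f(\mathbf Q,R)$ over all rates $R_i\ge0$ and all $\mathbf Q_i\succeq 0$ with $\operatorname{tr}(\mathbf Q_i)=P_i$ is attained with $\mathbf Q_i=\frac{P_i}{n_t}\mathbf I_{n_t}$ for all $i$ (and suitable rates); and the overall maximum $\mathcal R_f^m$ exists and is attained with $\mathbf Q_i=\frac{P_i}{n_t}\mathbf I_{n_t}$ for all $i$, for suitable $P_i$ and $R_i$. 2. With $\Gamma(n,x)=\int_x^\infty t^{n-1}e^{-t}\,dt$, $$\mathcal R_f^m=\max_{\substack{0<s_i<1,\ P_i\ge 0\\ \sum_{i=1}^K P_i=P}}\ \sum_{i=1}^K\frac{\Gamma(n_t,n_t s_i)}{(n_t-1)!}\ln\left(1+\frac{P_i s_i}{1+\sum_{j=i+1}^K P_j s_i}\right),$$ and the maximum on the right-hand side is attained. -/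

import Mathlib

open MeasureTheory ProbabilityTheory
open scoped ComplexOrder

/-- The circularly symmetric complex Gaussian law `CN(0,1)`: independent real and imaginary parts,
each `N(0,1/2)`. -/
noncomputable def stdComplexGaussian : Measure ℂ :=
  ((gaussianReal 0 (1 / 2)).prod (gaussianReal 0 (1 / 2))).map
    (fun p : ℝ × ℝ => (p.1 : ℂ) + (p.2 : ℂ) * Complex.I)

/-- `h` is the `1 × n` random channel vector of an `n × 1` MISO Rayleigh fading channel: its
entries are i.i.d. `CN(0,1)`. -/
structure IsRayleighChannel {Ω : Type*} [MeasurableSpace Ω] (μ : Measure Ω) {n : ℕ}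
    (h : Ω → Fin n → ℂ) : Prop where
  law : ∀ l, HasLaw (fun ω => h ω l) stdComplexGaussian μ
  indep : iIndepFun (fun l ω => h ω l) μ

/-- The received power `h Q h†` of a signal with covariance `Q` over the row vector `h`
(a real number when `Q` is Hermitian). -/
noncomputable def rxPower {n : ℕ} (h : Fin n → ℂ) (Q : Matrix (Fin n) (Fin n) ℂ) : ℝ :=
  (h ⬝ᵥ Q.mulVec (star h)).re

/-- Instantaneous mutual information (in nats) of layer `i`, with unit noise power and the layers
above `i` acting as Gaussian interference, the layers below `i` being removed. -/
noncomputable def layerMutualInfo {n K : ℕ} (Q : Fin K → Matrix (Fin n) (Fin n) ℂ)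
    (h : Fin n → ℂ) (i : Fin K) : ℝ :=
  Real.log (1 + rxPower h (Q i) / (1 + rxPower h (∑ j ∈ Finset.Ioi i, Q j)))

/-- The `K`-layer expected-rate `∑ i, Pr{𝓘 i ≥ R i} * R i`. -/
noncomputable def expectedRate {Ω : Type*} [MeasurableSpace Ω] (μ : Measure Ω) {n K : ℕ}
    (h : Ω → Fin n → ℂ) (Q : Fin K → Matrix (Fin n) (Fin n) ℂ) (R : Fin K → ℝ) : ℝ :=
  ∑ i, μ.real {ω | R i ≤ layerMutualInfo Q (h ω) i} * R i

/-- `p` distributes the total power `P` over the `K` layers. -/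
def IsPowerAllocation {K : ℕ} (P : ℝ) (p : Fin K → ℝ) : Prop :=
  (∀ i, 0 ≤ p i) ∧ ∑ i, p i = P

/-- All values of the expected-rate under the total power `P`: the layer powers, the rates and the
transmit covariance matrices, with `tr (Q i) ≤ p i`, are free. -/
def achievableExpectedRates {Ω : Type*} [MeasurableSpace Ω] (μ : Measure Ω) {n : ℕ}
    (h : Ω → Fin n → ℂ) (K : ℕ) (P : ℝ) : Set ℝ :=
  {v | ∃ (p : Fin K → ℝ) (Q : Fin K → Matrix (Fin n) (Fin n) ℂ) (R : Fin K → ℝ),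
    IsPowerAllocation P p ∧ (∀ i, (Q i).PosSemidef ∧ (Q i).trace.re ≤ p i) ∧ (∀ i, 0 ≤ R i) ∧
    v = expectedRate μ h Q R}

/-- All values of the expected-rate when layer `i` has power exactly `p i`: the rates and the
transmit covariance matrices, with `tr (Q i) = p i`, are free. -/
def expectedRatesWithPowers {Ω : Type*} [MeasurableSpace Ω] (μ : Measure Ω) {n K : ℕ}
    (h : Ω → Fin n → ℂ) (p : Fin K → ℝ) : Set ℝ :=
  {v | ∃ (Q : Fin K → Matrix (Fin n) (Fin n) ℂ) (R : Fin K → ℝ),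
    (∀ i, (Q i).PosSemidef ∧ (Q i).trace.re = p i) ∧ (∀ i, 0 ≤ R i) ∧ v = expectedRate μ h Q R}

/-- Equal power on all antennas with uncorrelated signals: `Q i = (p i / n) I`. -/
noncomputable def equalPowerCov {K : ℕ} (n : ℕ) (p : Fin K → ℝ) (i : Fin K) :
    Matrix (Fin n) (Fin n) ℂ :=
  ((p i / n : ℝ) : ℂ) • (1 : Matrix (Fin n) (Fin n) ℂ)

/-- The upper incomplete gamma function `Γ(a, x) = ∫ t in x..∞, t ^ (a - 1) * exp (-t)`. -/
noncomputable def upperIncompleteGamma (a x : ℝ) : ℝ :=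
  ∫ t in Set.Ioi x, t ^ (a - 1) * Real.exp (-t)

/-- The objective `∑ i, Γ(n, n s i) / (n-1)! * ln (1 + p i s i / (1 + ∑_{j > i} p j s i))`. -/
noncomputable def layeredObjective {K : ℕ} (n : ℕ) (p s : Fin K → ℝ) : ℝ :=
  ∑ i, upperIncompleteGamma n (n * s i) / (Nat.factorial (n - 1) : ℝ) *
    Real.log (1 + p i * s i / (1 + ∑ j ∈ Finset.Ioi i, p j * s i))

/-- The values of the objective over `0 < s i < 1` and over the power allocations. -/
def layeredObjectiveValues (n K : ℕ) (P : ℝ) : Set ℝ :=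
  {v | ∃ p s : Fin K → ℝ, IsPowerAllocation P p ∧ (∀ i, 0 < s i ∧ s i < 1) ∧
    v = layeredObjective n p s}

/-! The problem splits into one-layer problems. Let a layer have covariance A, interference
covariance B and rate R > 0, and put c = e^R − 1. It is decoded exactly when h(A/c − B)h† ≥ 1. By
unitary invariance of the Gaussian law, in an eigenbasis of A/c − B this form has the law of N = ∑
(αᵢ − βᵢ) xᵢ with independent exponential xᵢ and αᵢ, βᵢ ≥ 0, where a = ∑ αᵢ = tr A / c and b = ∑ βᵢ
= tr B (`exists_map_rxPower_eq`).

The heart is `exists_expProduct_real_ge_one_le`: some s in (0, 1] satisfies Pr{N ≥ 1} ≤ T(ns) q,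
where T is the Erlang tail and q = as/(1 + bs) ≤ 1. Write x as an Erlang radius times an independent
point u of the simplex; given u with N(u) > 0, the probability is T(1/N(u)). Although z ↦ T(1/z) is
not concave, it lies below the tangents needed here (`erlangTail_le_tangent`). Averaging a tangent
leaves only p = Pr{N > 0} and e = E max(N, 0), and memorylessness gives e + bp ≤ a
(`integral_posPart_add_measure_le`). The choice s = p/(a − bp) makes q = p and closes the estimate.
If that tangent is unusable, a smaller s whose tangent passes through the origin serves instead; one
exists in (0, 1] by `erlangTail_self_le`.

Bernoulli's inequality (1 + c)^q ≤ 1 + qc then bounds T(ns) q R by T(ns) ln(1 + s tr A/(1 + s tr B))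
(`exists_layerValue_ge`). This bound sees covariances only through traces, and isotropic covariances
attain it for every s > 0 (`expectedRate_equalPowerCov`). What remains is to maximise over powers
and thresholds: compactness gives a maximum, and `exists_isMax_layerValue` moves the thresholds
inside (0, 1). -/

/-! ### Erlang tail and density as real functions. -/

/-- The tail `e⁻ˣ ∑_{k < n} xᵏ / k!` of the Erlang law of shape `n` and rate `1`. -/
noncomputable def erlangTail (n : ℕ) (x : ℝ) : ℝ :=
  Real.exp (-x) * ∑ k ∈ Finset.range n, x ^ k / (Nat.factorial k : ℝ)

/-- The density `xⁿ⁻¹ e⁻ˣ / (n - 1)!` of the Erlang law of shape `n` and rate `1`. -/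
noncomputable def erlangDensity (n : ℕ) (x : ℝ) : ℝ :=
  Real.exp (-x) * (x ^ (n - 1) / (Nat.factorial (n - 1) : ℝ))

theorem erlangTail_zero {n : ℕ} (hn : 1 ≤ n) : erlangTail n 0 = 1 := by
  obtain ⟨m, rfl⟩ : ∃ m, n = m + 1 := ⟨n - 1, by omega⟩
  simp [erlangTail, Finset.sum_range_succ']

theorem erlangTail_pos {n : ℕ} (hn : 1 ≤ n) {x : ℝ} (hx : 0 ≤ x) : 0 < erlangTail n x := by
  obtain ⟨m, rfl⟩ : ∃ m, n = m + 1 := ⟨n - 1, by omega⟩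
  rw [erlangTail, Finset.sum_range_succ']
  have : 0 ≤ ∑ k ∈ Finset.range m, x ^ (k + 1) / ((k + 1).factorial : ℝ) :=
    Finset.sum_nonneg fun k _ => by positivity
  have h2 := Real.exp_pos (-x)
  simp only [pow_zero, Nat.factorial_zero, Nat.cast_one, div_one]
  positivity

theorem erlangDensity_nonneg (n : ℕ) {x : ℝ} (hx : 0 ≤ x) : 0 ≤ erlangDensity n x := by
  unfold erlangDensity; positivity

/-- Differentiation telescopes: the derivative of each term xᵏ/k! cancels against the preceding
term, and only the top one survives. -/
theorem hasDerivAt_erlangTail {n : ℕ} (hn : 1 ≤ n) (x : ℝ) :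
    HasDerivAt (erlangTail n) (-erlangDensity n x) x := by
  induction n, hn using Nat.le_induction with
  | base =>
    have h := (Real.hasDerivAt_exp (-x)).comp x (hasDerivAt_neg x)
    have e : erlangTail 1 = Real.exp ∘ Neg.neg := by ext y; simp [erlangTail]
    rw [e]
    simpa [erlangDensity] using h
  | succ n hn ih =>
    have h := (Real.hasDerivAt_exp (-x)).comp x (hasDerivAt_neg x)
    have h2 := ((hasDerivAt_pow n x).div_const (n.factorial : ℝ))
    have h3 := ih.add (h.mul h2)
    have e : erlangTail (n + 1) =
        erlangTail n + (Real.exp ∘ Neg.neg) * fun y => y ^ n / (n.factorial : ℝ) := by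
      ext y
      simp [erlangTail, Finset.sum_range_succ, mul_add]
    rw [e]
    refine h3.congr_deriv ?_
    obtain ⟨m, rfl⟩ : ∃ m, n = m + 1 := ⟨n - 1, by omega⟩
    simp only [erlangDensity, Nat.add_sub_cancel, Nat.factorial_succ, Function.comp]
    have : (m.factorial : ℝ) ≠ 0 := by positivity
    push_cast
    field_simp
    ring

theorem continuous_erlangTail (n : ℕ) : Continuous (erlangTail n) := by
  unfold erlangTail; fun_prop

theorem continuous_erlangDensity (n : ℕ) : Continuous (erlangDensity n) := by
  unfold erlangDensity; fun_prop

theorem tendsto_erlangTail (n : ℕ) :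
    Filter.Tendsto (erlangTail n) Filter.atTop (nhds 0) := by
  have : erlangTail n = fun x => ∑ k ∈ Finset.range n,
      (x ^ k * Real.exp (-x)) / (Nat.factorial k : ℝ) := by
    ext x
    rw [erlangTail, Finset.mul_sum]
    exact Finset.sum_congr rfl fun k _ => by ring
  rw [this, show (0 : ℝ) = ∑ k ∈ Finset.range n, 0 / (Nat.factorial k : ℝ) by simp]
  exact tendsto_finsetSum _ fun k _ => (Real.tendsto_pow_mul_exp_neg_atTop_nhds_zero k).div_const _

theorem integral_erlangDensity_Ioi {n : ℕ} (hn : 1 ≤ n) {x : ℝ} (hx : 0 ≤ x) :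
    IntegrableOn (erlangDensity n) (Set.Ioi x) ∧
      ∫ t in Set.Ioi x, erlangDensity n t = erlangTail n x := by
  have hd : ∀ t ∈ Set.Ioi x, HasDerivAt (fun t => -erlangTail n t) (erlangDensity n t) t := by
    intro t _
    simpa using (hasDerivAt_erlangTail hn t).fun_neg
  have hl : Filter.Tendsto (fun t => -erlangTail n t) Filter.atTop (nhds 0) := by
    simpa using (tendsto_erlangTail n).neg
  have hc : ContinuousWithinAt (fun t => -erlangTail n t) (Set.Ici x) x :=
    (continuous_erlangTail n).neg.continuousWithinAt
  have hp : ∀ t ∈ Set.Ioi x, 0 ≤ erlangDensity n t :=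
    fun t ht => erlangDensity_nonneg n (hx.trans (le_of_lt ht))
  refine ⟨integrableOn_Ioi_deriv_of_nonneg hc hd hp hl, ?_⟩
  rw [integral_Ioi_of_hasDerivAt_of_nonneg hc hd hp hl]
  simp

theorem upperIncompleteGamma_div_factorial {n : ℕ} (hn : 1 ≤ n) {x : ℝ} (hx : 0 ≤ x) :
    upperIncompleteGamma n x / (Nat.factorial (n - 1) : ℝ) = erlangTail n x := by
  rw [← (integral_erlangDensity_Ioi hn hx).2, upperIncompleteGamma, ← integral_div]
  refine setIntegral_congr_fun measurableSet_Ioi fun t ht => ?_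
  have : ((n : ℝ) - 1) = ((n - 1 : ℕ) : ℝ) := by rw [Nat.cast_sub hn]; simp
  simp only [erlangDensity, this, Real.rpow_natCast]
  ring

/-! ### Tangent bound for the Erlang tail. -/

/-- At the mean `n` of the Erlang law, the hazard rate is at least `1 / n`. -/
theorem erlangTail_self_le {n : ℕ} (hn : 1 ≤ n) :
    erlangTail n n ≤ n * erlangDensity n n := by
  -- The ratio of consecutive terms is n/(j + 1) ≥ 1 below index n, so the last of the n terms is
  -- the largest.
  have key : ∀ k ∈ Finset.range n,
      (n : ℝ) ^ k / (k.factorial : ℝ) ≤ (n : ℝ) ^ (n - 1) / ((n - 1).factorial : ℝ) := by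
    intro k hk
    have hk' : k ≤ n - 1 := by have := Finset.mem_range.1 hk; omega
    clear hk
    suffices H : ∀ j, k ≤ j → j ≤ n - 1 →
        (n : ℝ) ^ k / (k.factorial : ℝ) ≤ (n : ℝ) ^ j / (j.factorial : ℝ) from H _ hk' le_rfl
    intro j hj
    induction j, hj using Nat.le_induction with
    | base => intro; rfl
    | succ j hj ih =>
      intro hjn
      refine (ih (by omega)).trans ?_
      rw [Nat.factorial_succ, div_le_div_iff₀ (by positivity) (by positivity)]
      push_cast
      have h1 : (j : ℝ) + 1 ≤ n := by exact_mod_cast (by omega : j + 1 ≤ n)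
      have h2 : (0 : ℝ) ≤ (n : ℝ) ^ j * j.factorial := by positivity
      nlinarith [mul_le_mul_of_nonneg_left h1 h2, pow_succ (n : ℝ) j]
  calc erlangTail n n ≤ Real.exp (-n) *
        ∑ k ∈ Finset.range n, (n : ℝ) ^ (n - 1) / ((n - 1).factorial : ℝ) := by
        rw [erlangTail]
        exact mul_le_mul_of_nonneg_left (Finset.sum_le_sum key) (Real.exp_pos _).le
    _ = n * erlangDensity n n := by
        rw [erlangDensity, Finset.sum_const, Finset.card_range, nsmul_eq_mul]; ring

theorem hasDerivAt_exp_neg_mul_pow (n : ℕ) (t : ℝ) :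
    HasDerivAt (fun t => Real.exp (-t) * t ^ (n + 1)) (Real.exp (-t) * t ^ n * (n + 1 - t)) t := by
  have h := ((Real.hasDerivAt_exp (-t)).comp t (hasDerivAt_neg t)).mul (hasDerivAt_pow (n + 1) t)
  refine h.congr_deriv ?_
  simp only [Function.comp, Nat.add_sub_cancel]
  push_cast
  ring

/-- The mode is at n + 1. This unimodality governs the sign of the derivative in the tangent bound,
through `sq_mul_erlangDensity`. -/
theorem monotoneOn_exp_neg_mul_pow (n : ℕ) :
    MonotoneOn (fun t : ℝ => Real.exp (-t) * t ^ (n + 1)) (Set.Icc 0 (n + 1)) := by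
  refine monotoneOn_of_deriv_nonneg (convex_Icc _ _) (by fun_prop)
    (fun x _ => (hasDerivAt_exp_neg_mul_pow n x).differentiableAt.differentiableWithinAt) ?_
  intro x hx
  rw [interior_Icc] at hx
  rw [(hasDerivAt_exp_neg_mul_pow n x).deriv]
  have h1 := hx.1
  have h2 : 0 ≤ n + 1 - x := by linarith [hx.2]
  positivity

theorem antitoneOn_exp_neg_mul_pow (n : ℕ) :
    AntitoneOn (fun t : ℝ => Real.exp (-t) * t ^ (n + 1)) (Set.Ici (n + 1)) := by
  refine antitoneOn_of_deriv_nonpos (convex_Ici _) (by fun_prop)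
    (fun x _ => (hasDerivAt_exp_neg_mul_pow n x).differentiableAt.differentiableWithinAt) ?_
  intro x hx
  rw [interior_Ici] at hx
  rw [(hasDerivAt_exp_neg_mul_pow n x).deriv]
  have hx' : (n : ℝ) + 1 < x := hx
  have h1 : 0 < x := lt_trans (by positivity) hx'
  exact mul_nonpos_of_nonneg_of_nonpos (by positivity) (by linarith)

theorem sq_mul_erlangDensity {n : ℕ} (hn : 1 ≤ n) (t : ℝ) :
    t ^ 2 * erlangDensity n t = Real.exp (-t) * t ^ (n + 1) / ((n - 1).factorial : ℝ) := by
  obtain ⟨m, rfl⟩ : ∃ m, n = m + 1 := ⟨n - 1, by omega⟩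
  simp only [erlangDensity, Nat.add_sub_cancel]
  ring

/-- The function `z ↦ erlangTail n (1 / z)` lies below its tangent line at `1 / x`, as soon as
that line is nonnegative at `0`. -/
theorem erlangTail_le_tangent {n : ℕ} (hn : 1 ≤ n) {x : ℝ} (hx : 0 < x) (hxn : x ≤ n)
    (hd : x * erlangDensity n x ≤ erlangTail n x) {t : ℝ} (ht : 0 < t) :
    erlangTail n t ≤
      erlangTail n x - x * erlangDensity n x + x ^ 2 * erlangDensity n x / t := by
  set ψ : ℝ → ℝ := fun t => Real.exp (-t) * t ^ (n + 1) with hψ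
  have hf : (0 : ℝ) < ((n - 1).factorial : ℝ) := by positivity
  set D : ℝ → ℝ := fun t => x ^ 2 * erlangDensity n x / t - erlangTail n t with hD
  have hDd : ∀ u, 0 < u → HasDerivAt D ((ψ u - ψ x) / ((n - 1).factorial : ℝ) / u ^ 2) u := by
    intro u hu
    have h1 := ((hasDerivAt_inv hu.ne').const_mul (x ^ 2 * erlangDensity n x)).sub
      (hasDerivAt_erlangTail hn u)
    refine (h1.congr_deriv ?_).congr_of_eventuallyEq
      (Filter.Eventually.of_forall fun y => by simp [hD, div_eq_mul_inv])
    have e1 := sq_mul_erlangDensity hn u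
    have e2 := sq_mul_erlangDensity hn x
    rw [sub_div, show ψ u / ((n - 1).factorial : ℝ) = u ^ 2 * erlangDensity n u from e1.symm,
      show ψ x / ((n - 1).factorial : ℝ) = x ^ 2 * erlangDensity n x from e2.symm]
    field_simp
    ring
  have hDc : ∀ s ⊆ Set.Ioi (0 : ℝ), ContinuousOn D s := fun s hs u hu =>
    (hDd u (hs hu)).continuousAt.continuousWithinAt
  have hDdiff : ∀ s ⊆ Set.Ioi (0 : ℝ), DifferentiableOn ℝ D s := fun s hs u hu =>
    (hDd u (hs hu)).differentiableAt.differentiableWithinAt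
  have hDx : D x = x * erlangDensity n x - erlangTail n x := by
    simp only [hD]; field_simp
  have hxI : x ∈ Set.Icc (0 : ℝ) (n + 1) := ⟨hx.le, by linarith⟩
  suffices H : D x ≤ D t by
    simp only [hDx] at H; simp only [hD] at H; linarith
  -- D' has the sign of ψ − ψ x, and x lies left of the mode of ψ. So D falls up to x, rises while ψ
  -- ≥ ψ x, and then falls towards its limit 0. In the last regime D t ≥ 0 ≥ D x, and this is where
  -- `hd` is needed.
  rcases le_total t x with htx | htx
  · have hanti : AntitoneOn D (Set.Icc t x) := by
      have hsub : Set.Icc t x ⊆ Set.Ioi 0 := fun u hu => lt_of_lt_of_le ht hu.1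
      refine antitoneOn_of_deriv_nonpos (convex_Icc _ _) (hDc _ hsub)
        (hDdiff _ (interior_subset.trans hsub)) ?_
      intro u hu
      have hu' := interior_subset hu
      rw [(hDd u (hsub hu')).deriv]
      have : ψ u ≤ ψ x := monotoneOn_exp_neg_mul_pow n
        ⟨(hsub hu').le, hu'.2.trans hxI.2⟩ hxI hu'.2
      exact div_nonpos_of_nonpos_of_nonneg
        (div_nonpos_of_nonpos_of_nonneg (by linarith) hf.le) (by positivity)
    exact hanti ⟨le_rfl, htx⟩ ⟨htx, le_rfl⟩ htx
  rcases le_or_gt (ψ x) (ψ t) with hc | hc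
  · have hmono : MonotoneOn D (Set.Icc x t) := by
      have hsub : Set.Icc x t ⊆ Set.Ioi 0 := fun u hu => lt_of_lt_of_le hx hu.1
      refine monotoneOn_of_deriv_nonneg (convex_Icc _ _) (hDc _ hsub)
        (hDdiff _ (interior_subset.trans hsub)) ?_
      intro u hu
      have hu' := interior_subset hu
      rw [(hDd u (hsub hu')).deriv]
      have : ψ x ≤ ψ u := by
        rcases le_total u (n + 1) with h | h
        · exact monotoneOn_exp_neg_mul_pow n hxI ⟨(hsub hu').le, h⟩ hu'.1
        · exact hc.trans (antitoneOn_exp_neg_mul_pow n h (h.trans hu'.2) hu'.2)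
      exact div_nonneg (div_nonneg (by linarith) hf.le) (by positivity)
    exact hmono ⟨le_rfl, htx⟩ ⟨htx, le_rfl⟩ htx
  · have htn : (n : ℝ) + 1 ≤ t := by
      by_contra hlt
      push Not at hlt
      exact absurd (monotoneOn_exp_neg_mul_pow n hxI ⟨ht.le, hlt.le⟩ htx) (not_le.2 hc)
    have hanti : AntitoneOn D (Set.Ici t) := by
      have hsub : Set.Ici t ⊆ Set.Ioi 0 := fun u hu => lt_of_lt_of_le ht hu
      refine antitoneOn_of_deriv_nonpos (convex_Ici _) (hDc _ hsub)
        (hDdiff _ (interior_subset.trans hsub)) ?_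
      intro u hu
      have hu' := interior_subset hu
      rw [(hDd u (hsub hu')).deriv]
      have : ψ u ≤ ψ t := antitoneOn_exp_neg_mul_pow n htn (htn.trans hu') hu'
      exact div_nonpos_of_nonpos_of_nonneg
        (div_nonpos_of_nonpos_of_nonneg (by linarith) hf.le) (by positivity)
    have hlim : Filter.Tendsto (fun u => -erlangTail n u) Filter.atTop (nhds 0) := by
      simpa using (tendsto_erlangTail n).neg
    have h0 : 0 ≤ D t := by
      refine le_of_tendsto hlim ?_
      filter_upwards [Filter.eventually_ge_atTop t] with u hu
      have h1 := hanti Set.self_mem_Ici hu hu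
      have h2 : 0 ≤ x ^ 2 * erlangDensity n x / u :=
        div_nonneg (mul_nonneg (by positivity) (erlangDensity_nonneg n hx.le)) (ht.le.trans hu)
      have h3 : D u = x ^ 2 * erlangDensity n x / u - erlangTail n u := rfl
      linarith
    linarith

/-- Below any threshold `s₁` and below `1` there is a point at which the tangent bound applies and
which is either `s₁` or a point where the tangent passes through the origin. -/
theorem exists_tangent_point {n : ℕ} (hn : 1 ≤ n) {s₁ : ℝ} (hs₁ : 0 < s₁) :
    ∃ s, 0 < s ∧ s ≤ 1 ∧ s ≤ s₁ ∧
      n * s * erlangDensity n (n * s) ≤ erlangTail n (n * s) ∧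
      (s = s₁ ∨ n * s * erlangDensity n (n * s) = erlangTail n (n * s)) := by
  set g : ℝ → ℝ := fun s => erlangTail n (n * s) - n * s * erlangDensity n (n * s) with hg
  have hgc : Continuous g := by
    have := continuous_erlangTail n
    have := continuous_erlangDensity n
    fun_prop
  have hg0 : g 0 = 1 := by simp [hg, erlangTail_zero hn]
  have hg1 : g 1 ≤ 0 := by
    have := erlangTail_self_le hn
    simp only [hg, mul_one]; linarith
  by_cases hc : s₁ ≤ 1 ∧ 0 ≤ g s₁
  · exact ⟨s₁, hs₁, hc.1, le_rfl, by have := hc.2; simp only [hg] at this; linarith, Or.inl rfl⟩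
  -- Either s₁ itself violates the condition, or s₁ > 1 and the hazard bound at the mean gives g 1 ≤
  -- 0. Since g 0 = 1, a zero of g lies in between.
  · have hm : g (min s₁ 1) ≤ 0 := by
      rcases le_total s₁ 1 with h | h
      · rw [min_eq_left h]
        by_contra hcon
        exact hc ⟨h, by linarith⟩
      · rwa [min_eq_right h]
    obtain ⟨s, hs, hgs⟩ := intermediate_value_Icc' (le_min hs₁.le zero_le_one)
      hgc.continuousOn (show (0 : ℝ) ∈ Set.Icc (g (min s₁ 1)) (g 0) from ⟨hm, by simp [hg0]⟩)
    have hs0 : s ≠ 0 := by rintro rfl; rw [hg0] at hgs; exact one_ne_zero hgs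
    simp only [hg] at hgs
    exact ⟨s, lt_of_le_of_ne hs.1 hs0.symm, hs.2.trans (min_le_right _ _),
      hs.2.trans (min_le_left _ _), by linarith, Or.inr (by linarith)⟩

/-! ### The Erlang measure and memorylessness. -/

/-- The Erlang law of shape `n` and rate `1`; `erlangMeasure 1` is the exponential law. -/
noncomputable def erlangMeasure (n : ℕ) : Measure ℝ :=
  (volume.restrict (Set.Ioi 0)).withDensity fun t => ENNReal.ofReal (erlangDensity n t)

theorem measurable_ofReal_erlangDensity (n : ℕ) :
    Measurable fun t => ENNReal.ofReal (erlangDensity n t) :=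
  (continuous_erlangDensity n).measurable.ennreal_ofReal

theorem erlangMeasure_Ioi {n : ℕ} (hn : 1 ≤ n) {x : ℝ} (hx : 0 ≤ x) :
    erlangMeasure n (Set.Ioi x) = ENNReal.ofReal (erlangTail n x) := by
  obtain ⟨hi, he⟩ := integral_erlangDensity_Ioi hn hx
  rw [erlangMeasure, withDensity_apply _ measurableSet_Ioi, Measure.restrict_restrict
    measurableSet_Ioi, Set.inter_eq_left.2 (Set.Ioi_subset_Ioi hx), ← he,
    ofReal_integral_eq_lintegral_ofReal hi]
  filter_upwards [ae_restrict_mem measurableSet_Ioi] with t ht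
  exact erlangDensity_nonneg n (hx.trans (le_of_lt ht))

theorem ae_pos_erlangMeasure (n : ℕ) : ∀ᵐ t ∂erlangMeasure n, 0 < t :=
  (withDensity_absolutelyContinuous _ _).ae_le (ae_restrict_mem measurableSet_Ioi)

theorem isProbabilityMeasure_erlangMeasure {n : ℕ} (hn : 1 ≤ n) :
    IsProbabilityMeasure (erlangMeasure n) := by
  refine ⟨?_⟩
  have h : erlangMeasure n Set.univ = erlangMeasure n (Set.Ioi 0) := by
    refine measure_congr ?_
    filter_upwards [ae_pos_erlangMeasure n] with t ht
    simp only [eq_iff_iff]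
    exact ⟨fun _ => ht, fun _ => trivial⟩
  rw [h, erlangMeasure_Ioi hn le_rfl, erlangTail_zero hn, ENNReal.ofReal_one]

instance : IsProbabilityMeasure (erlangMeasure 1) := isProbabilityMeasure_erlangMeasure le_rfl

instance (n : ℕ) : NullSingletonClass (erlangMeasure n) := by unfold erlangMeasure; infer_instance

theorem erlangMeasure_real_Ici {n : ℕ} (hn : 1 ≤ n) {x : ℝ} (hx : 0 ≤ x) :
    (erlangMeasure n).real (Set.Ici x) = erlangTail n x := by
  rw [measureReal_def, ← measure_congr Ioi_ae_eq_Ici, erlangMeasure_Ioi hn hx,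
    ENNReal.toReal_ofReal (erlangTail_pos hn hx).le]

theorem integral_erlangMeasure (n : ℕ) (f : ℝ → ℝ) :
    ∫ t, f t ∂erlangMeasure n = ∫ t in Set.Ioi 0, erlangDensity n t * f t := by
  rw [erlangMeasure, integral_withDensity_eq_integral_toReal_smul
    (measurable_ofReal_erlangDensity n) (by simp)]
  refine setIntegral_congr_fun measurableSet_Ioi fun t ht => ?_
  simp [ENNReal.toReal_ofReal (erlangDensity_nonneg n (le_of_lt ht))]

theorem integrable_erlangMeasure_iff (n : ℕ) (f : ℝ → ℝ) :
    Integrable f (erlangMeasure n) ↔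
      IntegrableOn (fun t => erlangDensity n t * f t) (Set.Ioi 0) := by
  rw [erlangMeasure, integrable_withDensity_iff_integrable_smul'
    (measurable_ofReal_erlangDensity n) (by simp)]
  refine integrable_congr ?_
  filter_upwards [ae_restrict_mem measurableSet_Ioi] with t ht
  simp [ENNReal.toReal_ofReal (erlangDensity_nonneg n (le_of_lt ht))]

theorem erlangDensity_mul_self {n : ℕ} (hn : 1 ≤ n) (t : ℝ) :
    erlangDensity n t * t = n * erlangDensity (n + 1) t := by
  obtain ⟨m, rfl⟩ : ∃ m, n = m + 1 := ⟨n - 1, by omega⟩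
  simp only [erlangDensity, Nat.add_sub_cancel, Nat.factorial_succ]
  have : (m.factorial : ℝ) ≠ 0 := by positivity
  push_cast
  field_simp
  ring

theorem integrable_id_erlangMeasure {n : ℕ} (hn : 1 ≤ n) :
    Integrable (fun t : ℝ => t) (erlangMeasure n) := by
  rw [integrable_erlangMeasure_iff]
  simp only [erlangDensity_mul_self hn]
  exact (integral_erlangDensity_Ioi (Nat.le_add_left 1 n) le_rfl).1.const_mul _

theorem integral_id_erlangMeasure {n : ℕ} (hn : 1 ≤ n) : ∫ t, t ∂erlangMeasure n = n := by
  rw [integral_erlangMeasure]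
  simp only [erlangDensity_mul_self hn]
  rw [integral_const_mul, (integral_erlangDensity_Ioi (Nat.le_add_left 1 n) le_rfl).2,
    erlangTail_zero (Nat.le_add_left 1 n), mul_one]

/-- Memorylessness of the exponential law, in integrated form. -/
theorem integral_exponential_posPart {w ν : ℝ} (hν : 0 < ν) :
    ∫ z, (max (w - ν * z) 0 + ν * (Set.Ioi (0 : ℝ)).indicator 1 (w - ν * z)) ∂erlangMeasure 1 =
      max w 0 := by
  rw [integral_erlangMeasure]
  rcases le_or_gt w 0 with hw | hw
  · rw [max_eq_right hw]
    refine (setIntegral_congr_fun (g := fun _ => (0 : ℝ)) measurableSet_Ioi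
      fun z hz => ?_).trans (by simp)
    have hz' : (0 : ℝ) < z := hz
    have : w - ν * z < 0 := by nlinarith [mul_pos hν hz']
    have h2 : w ≤ ν * z := by linarith
    simp [this.le, h2]
  · rw [max_eq_left hw.le]
    set a := w / ν with ha
    have ha0 : 0 < a := div_pos hw hν
    have haw : ν * a = w := by rw [ha]; field_simp
    have h1 : ∫ z in Set.Ioi 0, erlangDensity 1 z *
        (max (w - ν * z) 0 + ν * (Set.Ioi (0 : ℝ)).indicator 1 (w - ν * z)) =
        ∫ z in Set.Ioi 0, (Set.Iio a).indicator
          (fun z => Real.exp (-z) * (w - ν * z + ν)) z := by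
      refine setIntegral_congr_fun measurableSet_Ioi fun z _ => ?_
      by_cases hz : z < a
      · have : 0 < w - ν * z := by nlinarith
        simp [hz, this, this.le, erlangDensity]
      · have : w - ν * z ≤ 0 := by push Not at hz; nlinarith
        have h2 : w ≤ ν * z := by linarith
        simp [hz, this, h2]
    -- The antiderivative −e^(−z)(w − νz) vanishes at the crossing point a = w/ν and equals −w at 0.
    rw [h1, setIntegral_indicator measurableSet_Iio, Set.Ioi_inter_Iio,
      ← integral_Ioc_eq_integral_Ioo, ← intervalIntegral.integral_of_le ha0.le,
      intervalIntegral.integral_eq_sub_of_hasDerivAt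
        (f := fun z => -(Real.exp (-z) * (w - ν * z)))]
    · simp [haw]
    · intro z _
      have h := ((Real.hasDerivAt_exp (-z)).comp z (hasDerivAt_neg z)).mul
        (((hasDerivAt_id z).const_mul ν).const_sub w)
      refine h.neg.congr_deriv ?_
      simp only [Function.comp, id]
      ring
    · exact (by fun_prop : Continuous fun z => Real.exp (-z) * (w - ν * z + ν)).intervalIntegrable
        _ _

/-- By independence one may integrate over Z with W fixed, which is the memorylessness identity. It
records exactly how much of the mean positive part is lost by subtracting one exponential variable.
-/
theorem integral_posPart_sub_exponential {Ω : Type*} [MeasurableSpace Ω] {μ : Measure Ω}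
    [IsProbabilityMeasure μ] {W Z : Ω → ℝ} (hW : Integrable W μ) (hZm : Measurable Z)
    (hWm : Measurable W) (hZ : μ.map Z = erlangMeasure 1) (hind : IndepFun W Z μ)
    {ν : ℝ} (hν : 0 < ν) :
    ∫ ω, max (W ω - ν * Z ω) 0 ∂μ + ν * μ.real {ω | 0 < W ω - ν * Z ω} =
      ∫ ω, max (W ω) 0 ∂μ := by
  have hZi : Integrable Z μ := by
    have := integrable_id_erlangMeasure (le_refl 1)
    rw [← hZ] at this
    exact this.comp_measurable hZm
  have hmap := (indepFun_iff_map_prod_eq_prod_map_map hWm.aemeasurable hZm.aemeasurable).1 hind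
  rw [hZ] at hmap
  set F : ℝ × ℝ → ℝ := fun q =>
    max (q.1 - ν * q.2) 0 + ν * (Set.Ioi (0 : ℝ)).indicator 1 (q.1 - ν * q.2) with hF
  have hFm : Measurable F := by
    have : Measurable fun q : ℝ × ℝ => q.1 - ν * q.2 := by fun_prop
    exact (this.max measurable_const).add
      (((measurable_one.indicator measurableSet_Ioi).comp this).const_mul ν)
  have hset : MeasurableSet {ω | 0 < W ω - ν * Z ω} :=
    measurableSet_lt measurable_const (hWm.sub (hZm.const_mul ν))
  have hi1 : Integrable (fun ω => max (W ω - ν * Z ω) 0) μ := (hW.sub (hZi.const_mul ν)).pos_part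
  have hind' : (fun ω => (Set.Ioi (0 : ℝ)).indicator (1 : ℝ → ℝ) (W ω - ν * Z ω)) =
      {ω | 0 < W ω - ν * Z ω}.indicator 1 := by
    ext ω; simp only [Set.indicator_apply, Set.mem_Ioi, Set.mem_ofPred_eq, Pi.one_apply]
  have hi2 : Integrable (fun ω => ν * (Set.Ioi (0 : ℝ)).indicator (1 : ℝ → ℝ) (W ω - ν * Z ω)) μ := by
    rw [show (fun ω => ν * (Set.Ioi (0 : ℝ)).indicator (1 : ℝ → ℝ) (W ω - ν * Z ω)) =
      fun ω => ν * {ω | 0 < W ω - ν * Z ω}.indicator (1 : Ω → ℝ) ω by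
        rw [← hind']]
    exact ((integrable_const 1).indicator hset).const_mul ν
  have hFi : Integrable (fun ω => F (W ω, Z ω)) μ := hi1.add hi2
  have e1 : ∫ ω, F (W ω, Z ω) ∂μ =
      ∫ ω, max (W ω - ν * Z ω) 0 ∂μ + ν * μ.real {ω | 0 < W ω - ν * Z ω} := by
    rw [integral_add hi1 hi2, integral_const_mul, hind', integral_indicator_one hset]
  have hWZ : Measurable fun ω => (W ω, Z ω) := hWm.prodMk hZm
  have hFi' : Integrable F ((μ.map W).prod (erlangMeasure 1)) := by
    rw [← hmap, integrable_map_measure hFm.aestronglyMeasurable hWZ.aemeasurable]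
    exact hFi
  have : IsProbabilityMeasure (μ.map W) := Measure.isProbabilityMeasure_map hWm.aemeasurable
  rw [← e1, ← integral_map hWZ.aemeasurable hFm.aestronglyMeasurable (f := F), hmap,
    integral_prod _ hFi']
  simp only [hF]
  simp only [integral_exponential_posPart hν]
  exact integral_map hWm.aemeasurable (by fun_prop)

/-! ### Positive parts of signed combinations of exponentials. -/

/-- The law of `n` independent exponential random variables. -/
noncomputable def expProduct (n : ℕ) : Measure (Fin n → ℝ) :=
  Measure.pi fun _ => erlangMeasure 1

instance (n : ℕ) : IsProbabilityMeasure (expProduct n) := by unfold expProduct; infer_instance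

theorem map_eval_expProduct {n : ℕ} (i : Fin n) :
    (expProduct n).map (fun x => x i) = erlangMeasure 1 :=
  (measurePreserving_eval (fun _ : Fin n => erlangMeasure 1) i).map_eq

theorem integrable_eval_expProduct {n : ℕ} (i : Fin n) :
    Integrable (fun x => x i) (expProduct n) := by
  have := integrable_id_erlangMeasure (le_refl 1)
  rw [← map_eval_expProduct i] at this
  exact this.comp_measurable (measurable_pi_apply i)

theorem integral_eval_expProduct {n : ℕ} (i : Fin n) : ∫ x, x i ∂expProduct n = 1 := by
  have h := integral_id_erlangMeasure (le_refl 1)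
  rw [← map_eval_expProduct i, integral_map (measurable_pi_apply i).aemeasurable (by fun_prop)] at h
  simpa using h

theorem ae_pos_expProduct (n : ℕ) : ∀ᵐ x ∂expProduct n, ∀ i, 0 < x i := by
  rw [ae_all_iff]
  intro i
  have := ae_pos_erlangMeasure 1
  rw [← map_eval_expProduct i] at this
  exact ae_of_ae_map (measurable_pi_apply i).aemeasurable this

theorem iIndepFun_eval_expProduct (n : ℕ) :
    iIndepFun (fun (i : Fin n) (x : Fin n → ℝ) => x i) (expProduct n) :=
  iIndepFun_pi (X := fun _ x => x) fun _ => aemeasurable_id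

/-- A linear combination of exponential random variables is new better than used in expectation. -/
theorem integral_posPart_add_measure_le {n : ℕ} (α β : Fin n → ℝ) (hα : ∀ i, 0 ≤ α i)
    (hβ : ∀ i, 0 ≤ β i) :
    ∫ x, max (∑ i, (α i - β i) * x i) 0 ∂expProduct n +
      (∑ i, β i) * (expProduct n).real {x | 0 < ∑ i, (α i - β i) * x i} ≤ ∑ i, α i := by
  classical
  set l : Fin n → ℝ := fun i => α i - β i with hl
  set N : Finset (Fin n) → (Fin n → ℝ) → ℝ := fun S x => ∑ i ∈ S, l i * x i with hN
  have hNm : ∀ S, Measurable (N S) := fun S => by fun_prop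
  have hNi : ∀ S, Integrable (N S) (expProduct n) := fun S =>
    integrable_finsetSum _ fun i _ => (integrable_eval_expProduct i).const_mul _
  set A := Finset.univ.filter fun i => 0 ≤ l i with hA
  -- Start from the nonnegative coefficients, whose sum is its own positive part, and subtract the
  -- negative ones one at a time.
  have key : ∀ B : Finset (Fin n), (∀ i ∈ B, l i < 0) →
      ∫ x, max (N (B ∪ A) x) 0 ∂expProduct n +
        (∑ i ∈ B, -l i) * (expProduct n).real {x | 0 < N (B ∪ A) x} ≤ ∑ i ∈ A, l i := by
    intro B
    induction B using Finset.induction_on with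
    | empty =>
      intro _
      simp only [Finset.empty_union, Finset.sum_empty, zero_mul, add_zero]
      have : ∫ x, max (N A x) 0 ∂expProduct n = ∫ x, N A x ∂expProduct n := by
        refine integral_congr_ae ?_
        filter_upwards [ae_pos_expProduct n] with x hx
        exact max_eq_left (Finset.sum_nonneg fun i hi =>
          mul_nonneg (Finset.mem_filter.1 hi).2 (hx i).le)
      rw [this, integral_finsetSum _ fun i _ => (integrable_eval_expProduct i).const_mul _]
      simp [integral_const_mul, integral_eval_expProduct]
    | insert j B hj ih =>
      intro hB
      have ih := ih fun i hi => hB i (Finset.mem_insert_of_mem hi)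
      have hlj : l j < 0 := hB j (Finset.mem_insert_self _ _)
      have hjA : j ∉ B ∪ A := by
        simp only [Finset.mem_union, not_or]
        exact ⟨hj, fun h => absurd (Finset.mem_filter.1 h).2 (not_le.2 hlj)⟩
      have hsplit : ∀ x, N (insert j B ∪ A) x = N (B ∪ A) x - (-l j) * x j := by
        intro x
        simp only [hN]
        rw [Finset.insert_union, Finset.sum_insert hjA]
        ring
      have hindep : IndepFun (N (B ∪ A)) (fun x => x j) (expProduct n) := by
        have h0 := ((iIndepFun_eval_expProduct n).indepFun_finset (B ∪ A) {j}
          (Finset.disjoint_singleton_right.2 hjA) fun i => measurable_pi_apply i)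
        have hψ : Measurable fun y : ({j} : Finset (Fin n)) → ℝ =>
            y ⟨j, Finset.mem_singleton_self j⟩ := measurable_pi_apply _
        have h1 := h0.comp (φ := fun y : (B ∪ A : Finset (Fin n)) → ℝ =>
            ∑ i : (B ∪ A : Finset (Fin n)), l i * y i)
          (ψ := fun y : ({j} : Finset (Fin n)) → ℝ => y ⟨j, Finset.mem_singleton_self j⟩)
          (by fun_prop) hψ
        convert h1 using 1
        · ext x
          simp only [hN, Function.comp]
          exact (Finset.sum_coe_sort (B ∪ A) fun i => l i * x i).symm
        · rfl
      have h2 := integral_posPart_sub_exponential (hNi (B ∪ A)) (measurable_pi_apply j)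
        (hNm _) (map_eval_expProduct j) hindep (neg_pos.2 hlj)
      -- Each subtraction shrinks the event of positivity, so the terms already collected may be
      -- re-weighted by the new, smaller probability.
      have hmono : (expProduct n).real {x | 0 < N (B ∪ A) x - (-l j) * x j} ≤
          (expProduct n).real {x | 0 < N (B ∪ A) x} := by
        refine ENNReal.toReal_mono (measure_ne_top _ _) (measure_mono_ae ?_)
        filter_upwards [ae_pos_expProduct n] with x hx h
        have h' : 0 < N (B ∪ A) x - (-l j) * x j := h
        have := mul_pos (neg_pos.2 hlj) (hx j)
        exact (by linarith : 0 < N (B ∪ A) x)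
      simp only [hsplit, Finset.sum_insert hj]
      have hs : 0 ≤ ∑ i ∈ B, -l i := Finset.sum_nonneg fun i hi =>
        (neg_pos.2 (hB i (Finset.mem_insert_of_mem hi))).le
      nlinarith [mul_le_mul_of_nonneg_left hmono hs]
  have hk := key (Finset.univ.filter fun i => ¬ 0 ≤ l i) fun i hi =>
    not_le.1 (Finset.mem_filter.1 hi).2
  have hu : (Finset.univ.filter fun i => ¬ 0 ≤ l i) ∪ A = Finset.univ := by
    rw [Finset.union_comm]; exact Finset.filter_union_filter_not_eq _ _
  rw [hu] at hk
  have hp1 : (expProduct n).real {x | 0 < N Finset.univ x} ≤ 1 := measureReal_le_one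
  have hsum : ∑ i ∈ A, l i + ∑ i with ¬ 0 ≤ l i, l i = ∑ i, α i - ∑ i, β i := by
    rw [Finset.sum_filter_add_sum_filter_not, Finset.sum_sub_distrib]
  have hv : ∑ i with ¬ 0 ≤ l i, -l i ≤ ∑ i, β i := by
    calc ∑ i with ¬ 0 ≤ l i, -l i ≤ ∑ i with ¬ 0 ≤ l i, β i :=
          Finset.sum_le_sum fun i _ => by simp only [hl]; linarith [hα i]
      _ ≤ ∑ i, β i := Finset.sum_le_univ_sum_of_nonneg hβ
  rw [Finset.sum_neg_distrib] at hk hv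
  change ∫ x, max (N Finset.univ x) 0 ∂expProduct n +
      (∑ i, β i) * (expProduct n).real {x | 0 < N Finset.univ x} ≤ ∑ i, α i
  -- So far the weight is v, the total size of the negative coefficients, against the bound ∑ α − ∑
  -- β + v. Raising v to ∑ β adds at most (∑ β − v) · 1 on the left, because the probability is at
  -- most 1.
  nlinarith [mul_nonneg (sub_nonneg.2 hv) (sub_nonneg.2 hp1)]

/-! ### Polar decomposition of exponential vectors. -/

theorem pi_withDensity_ofReal {ι : Type*} [Fintype ι] {X : ι → Type*}
    [∀ i, MeasurableSpace (X i)] (μ : ∀ i, Measure (X i)) [∀ i, SigmaFinite (μ i)]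
    (g : ∀ i, X i → ℝ) (hg : ∀ i, Integrable (g i) (μ i))
    (hg0 : ∀ i x, 0 ≤ g i x) :
    Measure.pi (fun i => (μ i).withDensity fun x => ENNReal.ofReal (g i x)) =
      (Measure.pi μ).withDensity fun x => ENNReal.ofReal (∏ i, g i (x i)) := by
  have : ∀ i, IsFiniteMeasure ((μ i).withDensity fun x => ENNReal.ofReal (g i x)) := fun i =>
    isFiniteMeasure_withDensity_ofReal (hg i).2
  refine Measure.pi_eq fun s hs => ?_
  rw [withDensity_apply _ (MeasurableSet.univ_pi hs), Measure.restrict_pi_pi,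
    ← ofReal_integral_eq_lintegral_ofReal, integral_fintype_prod_eq_prod,
    ENNReal.ofReal_prod_of_nonneg]
  · refine Finset.prod_congr rfl fun i _ => ?_
    rw [withDensity_apply _ (hs i), ofReal_integral_eq_lintegral_ofReal (hg i).integrableOn
      (Filter.Eventually.of_forall fun x => hg0 i x)]
  · exact fun i _ => integral_nonneg fun x => hg0 i x
  · exact Integrable.fintype_prod_dep fun i => (hg i).integrableOn
  · exact Filter.Eventually.of_forall fun x => Finset.prod_nonneg fun i _ => hg0 i _

/-- Polar integration with respect to a Haar measure of a normed space. -/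
theorem lintegral_eq_lintegral_toSphere {E : Type*} [NormedAddCommGroup E] [NormedSpace ℝ E]
    [MeasurableSpace E] [BorelSpace E] [FiniteDimensional ℝ E] [Nontrivial E] (μ : Measure E)
    [μ.IsAddHaarMeasure] {f : E → ENNReal} (hf : Measurable f) :
    ∫⁻ x, f x ∂μ = ∫⁻ ω, (∫⁻ r in Set.Ioi (0 : ℝ),
      ENNReal.ofReal (r ^ (Module.finrank ℝ E - 1)) * f (r • (ω : E))) ∂μ.toSphere := by
  have h1 : ∫⁻ x, f x ∂μ = ∫⁻ x : ({0}ᶜ : Set E), f x ∂μ.comap (↑) := by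
    rw [lintegral_subtype_comap (measurableSet_singleton _).compl, restrict_compl_singleton]
  have h2 := μ.measurePreserving_homeomorphUnitSphereProd.lintegral_comp_emb
    (Homeomorph.measurableEmbedding _)
    (fun q : Metric.sphere (0 : E) 1 × Set.Ioi (0 : ℝ) => f ((q.2 : ℝ) • (q.1 : E)))
  have h3 : ∀ x : ({0}ᶜ : Set E), ((homeomorphUnitSphereProd E x).2 : ℝ) •
      ((homeomorphUnitSphereProd E x).1 : E) = x := by
    intro x
    rw [← homeomorphUnitSphereProd_symm_apply_coe]
    simp
  simp only [h3] at h2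
  have hm : Measurable fun q : Metric.sphere (0 : E) 1 × Set.Ioi (0 : ℝ) =>
      f ((q.2 : ℝ) • (q.1 : E)) := by fun_prop
  rw [h1, h2, lintegral_prod _ hm.aemeasurable]
  refine lintegral_congr fun ω => ?_
  rw [Measure.volumeIoiPow, lintegral_withDensity_eq_lintegral_mul _ (by fun_prop)
    (by fun_prop)]
  exact lintegral_subtype_comap measurableSet_Ioi fun r : ℝ =>
    ENNReal.ofReal (r ^ (Module.finrank ℝ E - 1)) * f (r • (ω : E))

theorem expProduct_eq_withDensity (n : ℕ) :
    expProduct n = volume.withDensity fun x =>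
      ENNReal.ofReal (∏ i, (Set.Ioi (0 : ℝ)).indicator (erlangDensity 1) (x i)) := by
  have h1 : erlangMeasure 1 = (volume : Measure ℝ).withDensity fun t =>
      ENNReal.ofReal ((Set.Ioi (0 : ℝ)).indicator (erlangDensity 1) t) := by
    rw [erlangMeasure, ← withDensity_indicator measurableSet_Ioi]
    congr 1
    ext t
    by_cases ht : t ∈ Set.Ioi (0 : ℝ) <;> simp [ht]
  rw [expProduct]
  simp only [h1]
  rw [volume_pi]
  exact pi_withDensity_ofReal (fun _ => volume) _
    (fun _ => (integrable_indicator_iff measurableSet_Ioi).2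
      (integral_erlangDensity_Ioi le_rfl le_rfl).1)
    (fun _ x => Set.indicator_nonneg (fun t ht => erlangDensity_nonneg 1 (le_of_lt ht)) x)

theorem lintegral_Ioi_comp_mul {S : ℝ} (hS : 0 < S) (f : ℝ → ENNReal) (hf : Measurable f) :
    ∫⁻ r in Set.Ioi (0 : ℝ), f (S * r) =
      ENNReal.ofReal S⁻¹ * ∫⁻ t in Set.Ioi (0 : ℝ), f t := by
  have h := Real.map_volume_mul_left hS.ne'
  have h2 : ∫⁻ r, (Set.Ioi (0 : ℝ)).indicator f (S * r) =
      ∫⁻ t, (Set.Ioi (0 : ℝ)).indicator f t ∂(volume.map (S * ·)) :=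
    (lintegral_map (hf.indicator measurableSet_Ioi) (measurable_const_mul S)).symm
  rw [h, lintegral_smul_measure, lintegral_indicator measurableSet_Ioi,
    abs_of_pos (inv_pos.2 hS), smul_eq_mul] at h2
  rw [← h2, ← lintegral_indicator measurableSet_Ioi]
  refine lintegral_congr fun r => ?_
  by_cases hr : 0 < r
  · simp [hr, hS]
  · have : ¬ 0 < S * r := by simp only [not_lt] at hr ⊢; exact mul_nonpos_of_nonneg_of_nonpos hS.le hr
    simp [hr, this]

/-- A vector of independent exponential random variables is the product of an Erlang random
variable and an independent vector on the simplex. -/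
theorem exists_expProduct_eq_map {n : ℕ} (hn : 1 ≤ n) :
    ∃ κ : Measure (Fin n → ℝ), IsProbabilityMeasure κ ∧ (∀ᵐ u ∂κ, ∑ i, u i = 1) ∧
      expProduct n = (κ.prod (erlangMeasure n)).map fun q => q.2 • q.1 := by
  have : Nonempty (Fin n) := ⟨⟨0, hn⟩⟩
  have := isProbabilityMeasure_erlangMeasure hn
  set σ : Measure (Metric.sphere (0 : Fin n → ℝ) 1) := (volume : Measure (Fin n → ℝ)).toSphere
  set pos : Set (Metric.sphere (0 : Fin n → ℝ) 1) := {ω | ∀ i, 0 < (ω : Fin n → ℝ) i} with hpos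
  have hposm : MeasurableSet pos := by
    simp only [hpos, Set.ofPred_forall]
    exact MeasurableSet.iInter fun i => measurableSet_lt measurable_const
      ((measurable_pi_apply i).comp measurable_subtype_coe)
  set S : Metric.sphere (0 : Fin n → ℝ) 1 → ℝ := fun ω => ∑ i, (ω : Fin n → ℝ) i with hSdef
  have hSm : Measurable S := by fun_prop
  have hSpos : ∀ ω ∈ pos, 0 < S ω := fun ω hω =>
    Finset.sum_pos (fun i _ => hω i) Finset.univ_nonempty
  -- The sphere is that of the sup norm, so directions still have to be rescaled by S to reach the
  -- simplex. The factor (n − 1)! S⁻ⁿ is the integral of r^(n−1) e^(−Sr) over the ray.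
  set w : Metric.sphere (0 : Fin n → ℝ) 1 → ENNReal := fun ω =>
    ENNReal.ofReal ((n - 1).factorial * (S ω)⁻¹ ^ n) with hw
  have hwm : Measurable w := by fun_prop
  set τ := (σ.restrict pos).withDensity w with hτ
  set u : Metric.sphere (0 : Fin n → ℝ) 1 → Fin n → ℝ := fun ω => (S ω)⁻¹ • (ω : Fin n → ℝ) with hu
  have hum : Measurable u := by fun_prop
  have hτpos : ∀ᵐ ω ∂τ, ω ∈ pos :=
    (withDensity_absolutelyContinuous _ _).ae_le (ae_restrict_mem hposm)
  have hmain : ∀ f : (Fin n → ℝ) → ENNReal, Measurable f →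
      ∫⁻ x, f x ∂expProduct n =
        ∫⁻ v, ∫⁻ t, f (t • v) ∂erlangMeasure n ∂(τ.map u) := by
    intro f hf
    have hinner : ∀ ω, ω ∈ pos → ∫⁻ r in Set.Ioi (0 : ℝ), ENNReal.ofReal (r ^ (n - 1)) *
        (ENNReal.ofReal (∏ i, (Set.Ioi (0 : ℝ)).indicator (erlangDensity 1)
          ((r • (ω : Fin n → ℝ)) i)) * f (r • (ω : Fin n → ℝ))) =
        w ω * ∫⁻ t, f (t • u ω) ∂erlangMeasure n := by
      intro ω hω
      have hS := hSpos ω hω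
      have hfm : Measurable fun t : ℝ => f (t • u ω) := by fun_prop
      have hdm := measurable_ofReal_erlangDensity n
      rw [erlangMeasure, lintegral_withDensity_eq_lintegral_mul _ hdm hfm]
      have hsub := lintegral_Ioi_comp_mul hS
        (fun t => ENNReal.ofReal (erlangDensity n t) * f (t • u ω)) (hdm.mul hfm)
      have hw' : w ω = ENNReal.ofReal ((n - 1).factorial * (S ω)⁻¹ ^ (n - 1)) *
          ENNReal.ofReal (S ω)⁻¹ := by
        have hp : (S ω)⁻¹ ^ n = (S ω)⁻¹ ^ (n - 1) * (S ω)⁻¹ := by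
          rw [← pow_succ, Nat.sub_add_cancel hn]
        simp only [hw]
        rw [← ENNReal.ofReal_mul (by positivity), hp, mul_assoc]
      simp only [Pi.mul_apply]
      rw [hw', mul_assoc, ← hsub, ← lintegral_const_mul' _ _ ENNReal.ofReal_ne_top]
      refine setLIntegral_congr_fun measurableSet_Ioi fun r hr => ?_
      -- After the substitution t = S r the exponential density on the ray depends on t alone, so
      -- the radius becomes independent of the direction.
      have hr' : (0 : ℝ) < r := hr
      have e1 : (S ω * r) • u ω = r • (ω : Fin n → ℝ) := by
        rw [hu, smul_smul]
        congr 1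
        field_simp
      have e2 : ∏ i, (Set.Ioi (0 : ℝ)).indicator (erlangDensity 1) ((r • (ω : Fin n → ℝ)) i) =
          Real.exp (-(S ω * r)) := by
        have : ∀ i, (Set.Ioi (0 : ℝ)).indicator (erlangDensity 1) ((r • (ω : Fin n → ℝ)) i) =
            Real.exp (-((ω : Fin n → ℝ) i * r)) := by
          intro i
          have : (r • (ω : Fin n → ℝ)) i ∈ Set.Ioi (0 : ℝ) := mul_pos hr' (hω i)
          rw [Set.indicator_of_mem this]
          simp [erlangDensity, mul_comm]
        simp only [this]
        rw [← Real.exp_sum, Finset.sum_neg_distrib, hSdef, Finset.sum_mul]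
      simp only [e1, e2]
      rw [← mul_assoc, ← mul_assoc, ← ENNReal.ofReal_mul (by positivity),
        ← ENNReal.ofReal_mul (by positivity)]
      congr 2
      have : ((n - 1).factorial : ℝ) ≠ 0 := by positivity
      simp only [erlangDensity, mul_pow, inv_pow]
      field_simp
    have hρm : Measurable fun x : Fin n → ℝ => ENNReal.ofReal
        (∏ i, (Set.Ioi (0 : ℝ)).indicator (erlangDensity 1) (x i)) := by
      have : Measurable ((Set.Ioi (0 : ℝ)).indicator (erlangDensity 1)) :=
        (continuous_erlangDensity 1).measurable.indicator measurableSet_Ioi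
      fun_prop
    have hkm : Measurable fun v : Fin n → ℝ => ∫⁻ t, f (t • v) ∂erlangMeasure n := by
      have : Measurable fun q : (Fin n → ℝ) × ℝ => f (q.2 • q.1) := by fun_prop
      exact this.lintegral_prod_right'
    have hkum : Measurable fun ω => ∫⁻ t, f (t • u ω) ∂erlangMeasure n := hkm.comp hum
    rw [expProduct_eq_withDensity, lintegral_withDensity_eq_lintegral_mul _ hρm hf,
      lintegral_eq_lintegral_toSphere _ (hρm.mul hf), lintegral_map hkm hum, hτ,
      lintegral_withDensity_eq_lintegral_mul _ hwm hkum,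
      ← lintegral_indicator hposm]
    refine lintegral_congr fun ω => ?_
    by_cases hω : ω ∈ pos
    · rw [Set.indicator_of_mem hω]
      simp only [Module.finrank_fin_fun, Pi.mul_apply]
      exact hinner ω hω
    · rw [Set.indicator_of_notMem hω]
      simp only [hpos, Set.mem_ofPred_eq, not_forall, not_lt] at hω
      obtain ⟨j, hj⟩ := hω
      rw [lintegral_eq_zero_iff' (by fun_prop)]
      filter_upwards [ae_restrict_mem measurableSet_Ioi] with r hr
      have hr' : (0 : ℝ) < r := hr
      have : (r • (ω : Fin n → ℝ)) j ∉ Set.Ioi (0 : ℝ) := by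
        simp only [Pi.smul_apply, smul_eq_mul, Set.mem_Ioi, not_lt]
        exact mul_nonpos_of_nonneg_of_nonpos hr'.le hj
      have h0 : ∏ i, (Set.Ioi (0 : ℝ)).indicator (erlangDensity 1) ((r • (ω : Fin n → ℝ)) i) = 0 :=
        Finset.prod_eq_zero (Finset.mem_univ j) (Set.indicator_of_notMem this _)
      simp only [Pi.mul_apply, h0, ENNReal.ofReal_zero, zero_mul, mul_zero, Pi.zero_apply]
  have hprob : IsProbabilityMeasure (τ.map u) := by
    refine ⟨?_⟩
    have := hmain 1 measurable_one
    simp only [Pi.one_apply, lintegral_const, measure_univ, mul_one] at this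
    simpa using this.symm
  refine ⟨τ.map u, hprob, ?_, ?_⟩
  · rw [ae_map_iff hum.aemeasurable (measurableSet_eq_fun (by fun_prop) measurable_const)]
    filter_upwards [hτpos] with ω hω
    simp only [hu, Pi.smul_apply, smul_eq_mul, ← Finset.mul_sum]
    exact inv_mul_cancel₀ (hSpos ω hω).ne'
  · refine Measure.ext_of_lintegral _ fun f hf => ?_
    rw [hmain f hf, lintegral_map hf (by fun_prop), lintegral_prod _ (by fun_prop)]

/-- Simplex vectors have coordinate sum 1, so the sum is the Erlang radius itself. -/
theorem expProduct_real_sum_ge {n : ℕ} (hn : 1 ≤ n) {x : ℝ} (hx : 0 ≤ x) :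
    (expProduct n).real {y | x ≤ ∑ i, y i} = erlangTail n x := by
  obtain ⟨κ, hκ, hsum, hmap⟩ := exists_expProduct_eq_map hn
  have := isProbabilityMeasure_erlangMeasure hn
  have hms : MeasurableSet {y : Fin n → ℝ | x ≤ ∑ i, y i} :=
    measurableSet_le measurable_const (by fun_prop)
  rw [← erlangMeasure_real_Ici hn hx, hmap, measureReal_def, measureReal_def,
    Measure.map_apply (by fun_prop) hms]
  congr 1
  have h1 : (κ.prod (erlangMeasure n)) (Set.univ ×ˢ Set.Ici x) = erlangMeasure n (Set.Ici x) := by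
    rw [Measure.prod_prod, measure_univ, one_mul]
  rw [← h1]
  refine measure_congr ?_
  have h2 : ∀ᵐ q ∂κ.prod (erlangMeasure n), ∑ i, q.1 i = 1 :=
    Measure.quasiMeasurePreserving_fst.ae hsum
  filter_upwards [h2] with q hq
  have : ∑ i, (q.2 • q.1) i = q.2 := by
    simp only [Pi.smul_apply, smul_eq_mul, ← Finset.mul_sum, hq, mul_one]
  refine propext ?_
  change x ≤ ∑ i, (q.2 • q.1) i ↔ q ∈ Set.univ ×ˢ Set.Ici x
  rw [this]
  simp

/-! ### Averaging the tangent bound. -/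

/-- The tail of a linear combination of exponential random variables, bounded through the tangent
of the Erlang tail. -/
theorem expProduct_real_ge_one_le {n : ℕ} (hn : 1 ≤ n) (l : Fin n → ℝ) {x : ℝ} (hx : 0 < x)
    (hxn : x ≤ n) (hd : x * erlangDensity n x ≤ erlangTail n x) :
    (expProduct n).real {y | 1 ≤ ∑ i, l i * y i} ≤
      (erlangTail n x - x * erlangDensity n x) * (expProduct n).real {y | 0 < ∑ i, l i * y i} +
        x ^ 2 * erlangDensity n x / n * ∫ y, max (∑ i, l i * y i) 0 ∂expProduct n := by
  obtain ⟨κ, hκ, -, hmap⟩ := exists_expProduct_eq_map hn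
  have := isProbabilityMeasure_erlangMeasure hn
  set N : (Fin n → ℝ) → ℝ := fun y => ∑ i, l i * y i with hN
  have hNm : Measurable N := by fun_prop
  have hNi : Integrable N (expProduct n) :=
    integrable_finsetSum _ fun i _ => (integrable_eval_expProduct i).const_mul _
  set C₁ := erlangTail n x - x * erlangDensity n x with hC₁
  set C₂ := x ^ 2 * erlangDensity n x / n with hC₂
  -- The indicator to be estimated minus its proposed bound. The division by n in C₂ compensates for
  -- the mean n of the radius.
  set g : ℝ → ℝ := fun q => (Set.Ici (1 : ℝ)).indicator 1 q -
    (C₁ * (Set.Ioi (0 : ℝ)).indicator 1 q + C₂ * max q 0) with hg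
  have hgm : Measurable g :=
    (measurable_one.indicator measurableSet_Ici).sub
      (((measurable_one.indicator measurableSet_Ioi).const_mul _).add
        ((measurable_id.max measurable_const).const_mul _))
  have m1 : MeasurableSet {y | 1 ≤ N y} := measurableSet_le measurable_const hNm
  have m2 : MeasurableSet {y | 0 < N y} := measurableSet_lt measurable_const hNm
  have e1 : (fun y => (Set.Ici (1 : ℝ)).indicator (1 : ℝ → ℝ) (N y)) =
      {y | 1 ≤ N y}.indicator 1 := by
    ext y; simp only [Set.indicator_apply, Set.mem_Ici, Set.mem_ofPred_eq, Pi.one_apply]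
  have e2 : (fun y => (Set.Ioi (0 : ℝ)).indicator (1 : ℝ → ℝ) (N y)) =
      {y | 0 < N y}.indicator 1 := by
    ext y; simp only [Set.indicator_apply, Set.mem_Ioi, Set.mem_ofPred_eq, Pi.one_apply]
  have i1 : Integrable (fun y => (Set.Ici (1 : ℝ)).indicator (1 : ℝ → ℝ) (N y)) (expProduct n) := by
    rw [e1]; exact (integrable_const 1).indicator m1
  have i2 : Integrable (fun y => (Set.Ioi (0 : ℝ)).indicator (1 : ℝ → ℝ) (N y)) (expProduct n) := by
    rw [e2]; exact (integrable_const 1).indicator m2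
  have i3 : Integrable (fun y => max (N y) 0) (expProduct n) := hNi.pos_part
  have i4 : Integrable (fun y => C₁ * (Set.Ioi (0 : ℝ)).indicator (1 : ℝ → ℝ) (N y) +
      C₂ * max (N y) 0) (expProduct n) := (i2.const_mul _).add (i3.const_mul _)
  have hgi : Integrable (fun y => g (N y)) (expProduct n) := i1.sub i4
  have hint : ∫ y, g (N y) ∂expProduct n = (expProduct n).real {y | 1 ≤ N y} -
      (C₁ * (expProduct n).real {y | 0 < N y} + C₂ * ∫ y, max (N y) 0 ∂expProduct n) := by
    simp only [hg]
    rw [integral_sub i1 i4,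
      integral_add (i2.const_mul _) (i3.const_mul _), integral_const_mul, integral_const_mul,
      e1, e2, integral_indicator_one m1, integral_indicator_one m2]
  suffices H : ∫ y, g (N y) ∂expProduct n ≤ 0 by rw [hint] at H; linarith
  have hgNm : Measurable fun y => g (N y) := hgm.comp hNm
  have hsm : Measurable fun q : (Fin n → ℝ) × ℝ => q.2 • q.1 := by fun_prop
  have hgi' : Integrable (fun q : (Fin n → ℝ) × ℝ => g (N (q.2 • q.1)))
      (κ.prod (erlangMeasure n)) := by
    rw [hmap, integrable_map_measure hgNm.aestronglyMeasurable hsm.aemeasurable] at hgi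
    exact hgi
  rw [hmap, integral_map hsm.aemeasurable hgNm.aestronglyMeasurable, integral_prod _ hgi']
  -- It is enough to average over the radius in each fixed direction: N is homogeneous, so N ≥ 1
  -- becomes t ≥ 1/N(u), and the tangent bound applies at 1/N(u).
  refine integral_nonpos fun u => ?_
  have hNs : ∀ t, N (t • u) = t * N u := fun t => by
    simp only [hN, Pi.smul_apply, smul_eq_mul, Finset.mul_sum]
    exact Finset.sum_congr rfl fun i _ => by ring
  simp only [hNs, Pi.zero_apply]
  rcases le_or_gt (N u) 0 with hq | hq
  · refine le_of_eq (integral_eq_zero_of_ae ?_)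
    filter_upwards [ae_pos_erlangMeasure n] with t ht
    have h0 : t * N u ≤ 0 := mul_nonpos_of_nonneg_of_nonpos ht.le hq
    have h1 : ¬ 1 ≤ t * N u := by linarith
    simp [hg, h0, h1]
  · have hn0 : (0 : ℝ) < n := by exact_mod_cast hn
    have hcongr : (fun t => g (t * N u)) =ᵐ[erlangMeasure n] fun t =>
        (Set.Ici (1 / N u)).indicator 1 t - (C₁ + C₂ * N u * t) := by
      filter_upwards [ae_pos_erlangMeasure n] with t ht
      have h0 : 0 < t * N u := mul_pos ht hq
      have h1 : 1 / N u ≤ t ↔ 1 ≤ t * N u := div_le_iff₀ hq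
      simp only [hg, Set.indicator_apply, Set.mem_Ici, Set.mem_Ioi, h0, h1, max_eq_left h0.le,
        Pi.one_apply, if_true]
      ring
    have j1 : Integrable ((Set.Ici (1 / N u)).indicator (1 : ℝ → ℝ)) (erlangMeasure n) :=
      (integrable_const 1).indicator measurableSet_Ici
    have j2 : Integrable (fun t => C₁ + C₂ * N u * t) (erlangMeasure n) :=
      (integrable_const _).add ((integrable_id_erlangMeasure hn).const_mul _)
    rw [integral_congr_ae hcongr, integral_sub j1 j2,
      integral_indicator_one measurableSet_Ici,
      integral_add (integrable_const _) ((integrable_id_erlangMeasure hn).const_mul _),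
      integral_const_mul, integral_id_erlangMeasure hn,
      erlangMeasure_real_Ici hn (one_div_nonneg.2 hq.le)]
    have ht := erlangTail_le_tangent hn hx hxn hd (one_div_pos.2 hq)
    have e3 : C₂ * N u * n = x ^ 2 * erlangDensity n x / (1 / N u) := by
      rw [hC₂]; field_simp
    simp only [integral_const, probReal_univ, smul_eq_mul, one_mul]
    rw [e3]
    linarith

/-! ### Complex Gaussian vectors and unitary invariance. -/

theorem gaussianPDFReal_half (x : ℝ) :
    gaussianPDFReal 0 (1 / 2) x = (Real.sqrt Real.pi)⁻¹ * Real.exp (-x ^ 2) := by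
  rw [gaussianPDFReal]
  have h : ((1 / 2 : NNReal) : ℝ) = 1 / 2 := by norm_num
  rw [h]
  congr 1
  · congr 2; ring
  · congr 1; ring

theorem stdComplexGaussian_eq_withDensity :
    stdComplexGaussian = volume.withDensity fun z =>
      ENNReal.ofReal (Real.pi⁻¹ * Real.exp (-Complex.normSq z)) := by
  have hv : (1 / 2 : NNReal) ≠ 0 := by norm_num
  have hdm : Measurable fun z : ℂ => ENNReal.ofReal (Real.pi⁻¹ * Real.exp (-Complex.normSq z)) := by
    have := Complex.continuous_normSq
    exact (by fun_prop : Continuous fun z : ℂ =>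
      Real.pi⁻¹ * Real.exp (-Complex.normSq z)).measurable.ennreal_ofReal
  refine Measure.ext_of_lintegral _ fun f hf => ?_
  have hm : Measurable fun p : ℝ × ℝ => (p.1 : ℂ) + (p.2 : ℂ) * Complex.I := by fun_prop
  rw [stdComplexGaussian, lintegral_map hf hm, gaussianReal_of_var_ne_zero _ hv,
    prod_withDensity (measurable_gaussianPDF _ _) (measurable_gaussianPDF _ _),
    ← Measure.volume_eq_prod,
    lintegral_withDensity_eq_lintegral_mul _ (by fun_prop) (by fun_prop),
    lintegral_withDensity_eq_lintegral_mul _ hdm hf,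
    ← Complex.volume_preserving_equiv_real_prod.symm.lintegral_comp_emb
      Complex.measurableEquivRealProd.symm.measurableEmbedding]
  refine lintegral_congr fun p => ?_
  have e : Complex.measurableEquivRealProd.symm p = (p.1 : ℂ) + (p.2 : ℂ) * Complex.I := by
    apply Complex.ext <;> simp
  simp only [Pi.mul_apply, e]
  congr 1
  rw [gaussianPDF, gaussianPDF, ← ENNReal.ofReal_mul (gaussianPDFReal_nonneg _ _ _),
    gaussianPDFReal_half, gaussianPDFReal_half, Complex.normSq_add_mul_I]
  congr 1
  rw [neg_add, Real.exp_add]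
  have : (Real.sqrt Real.pi)⁻¹ * (Real.sqrt Real.pi)⁻¹ = Real.pi⁻¹ := by
    rw [← mul_inv, Real.mul_self_sqrt Real.pi_pos.le]
  rw [← this]
  ring

instance : IsProbabilityMeasure stdComplexGaussian := by
  unfold stdComplexGaussian
  exact Measure.isProbabilityMeasure_map (by fun_prop)

/-- In polar coordinates the angle contributes 2π, and t = r² turns 2r e^(−r²) dr into e^(−t) dt. -/
theorem map_normSq_stdComplexGaussian :
    stdComplexGaussian.map Complex.normSq = erlangMeasure 1 := by
  have hnm : Measurable Complex.normSq := Complex.continuous_normSq.measurable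
  have hdm : Measurable fun z : ℂ => ENNReal.ofReal (Real.pi⁻¹ * Real.exp (-Complex.normSq z)) := by
    fun_prop
  refine Measure.ext_of_lintegral _ fun f hf => ?_
  have hfm : Measurable fun z => f (Complex.normSq z) := hf.comp hnm
  rw [lintegral_map hf hnm, stdComplexGaussian_eq_withDensity,
    lintegral_withDensity_eq_lintegral_mul _ hdm hfm,
    erlangMeasure, lintegral_withDensity_eq_lintegral_mul _ (measurable_ofReal_erlangDensity 1) hf,
    ← Complex.lintegral_comp_polarCoord_symm, polarCoord_target, Measure.volume_eq_prod,
    ← Measure.prod_restrict]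
  have h1 : ∀ p : ℝ × ℝ, Complex.normSq (Complex.polarCoord.symm p) = p.1 ^ 2 := by
    intro p
    rw [Complex.normSq_eq_norm_sq, Complex.norm_polarCoord_symm, sq_abs]
  simp only [Pi.mul_apply, h1, smul_eq_mul]
  rw [lintegral_prod _ (by fun_prop)]
  simp only [lintegral_const, Measure.restrict_apply MeasurableSet.univ, Set.univ_inter,
    Real.volume_Ioo]
  have himg : (fun r : ℝ => r ^ 2) '' Set.Ioi 0 = Set.Ioi 0 := by
    ext t
    constructor
    · rintro ⟨r, hr, rfl⟩
      have : (0 : ℝ) < r := hr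
      exact (by positivity : (0 : ℝ) < r ^ 2)
    · intro ht
      exact ⟨Real.sqrt t, Real.sqrt_pos.2 ht, Real.sq_sqrt (le_of_lt ht)⟩
  have hcov := lintegral_image_eq_lintegral_abs_deriv_mul (s := Set.Ioi (0 : ℝ))
    (f := fun r => r ^ 2) (f' := fun r => 2 * r) measurableSet_Ioi
    (fun r _ => by simpa using (hasDerivAt_pow 2 r).hasDerivWithinAt)
    (fun a ha b hb h => by
      exact (pow_left_inj₀ (le_of_lt ha) (le_of_lt hb) two_ne_zero).1 h)
    (fun t => ENNReal.ofReal (erlangDensity 1 t) * f t)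
  rw [himg] at hcov
  rw [hcov]
  refine setLIntegral_congr_fun measurableSet_Ioi fun r hr => ?_
  have hr' : (0 : ℝ) < r := hr
  have hpi := Real.pi_pos
  simp only [← mul_assoc]
  rw [mul_right_comm, ← ENNReal.ofReal_mul hr'.le, ← ENNReal.ofReal_mul (by positivity),
    ← ENNReal.ofReal_mul (by positivity)]
  congr 2
  simp only [erlangDensity, abs_of_pos (by positivity : 0 < 2 * r)]
  simp
  field_simp
  ring

/-- The law of `n` independent `CN(0,1)` random variables. -/
noncomputable def rayleighLaw (n : ℕ) : Measure (Fin n → ℂ) :=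
  Measure.pi fun _ => stdComplexGaussian

instance (n : ℕ) : IsProbabilityMeasure (rayleighLaw n) := by unfold rayleighLaw; infer_instance

theorem map_normSq_rayleighLaw (n : ℕ) :
    (rayleighLaw n).map (fun z i => Complex.normSq (z i)) = expProduct n := by
  have : IsProbabilityMeasure (stdComplexGaussian.map Complex.normSq) := by
    rw [map_normSq_stdComplexGaussian]; infer_instance
  rw [rayleighLaw, Measure.pi_map_pi (f := fun _ z => Complex.normSq z)
    fun _ => Complex.continuous_normSq.measurable.aemeasurable, expProduct]
  simp only [map_normSq_stdComplexGaussian]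

/-- The density depends on z only through ∑ |zᵢ|², which unitary maps preserve. -/
theorem rayleighLaw_eq_withDensity (n : ℕ) :
    rayleighLaw n = volume.withDensity fun z =>
      ENNReal.ofReal (Real.pi⁻¹ ^ n * Real.exp (-∑ i, Complex.normSq (z i))) := by
  have hi : Integrable fun z : ℂ => Real.pi⁻¹ * Real.exp (-Complex.normSq z) := by
    refine ⟨(by fun_prop : Measurable _).aestronglyMeasurable, ?_⟩
    have h := measure_lt_top stdComplexGaussian Set.univ
    rw [stdComplexGaussian_eq_withDensity, withDensity_apply _ MeasurableSet.univ,
      Measure.restrict_univ] at h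
    rwa [hasFiniteIntegral_iff_ofReal (Filter.Eventually.of_forall fun z => by positivity)]
  rw [rayleighLaw, stdComplexGaussian_eq_withDensity, volume_pi, pi_withDensity_ofReal _ _
    (fun _ => hi) (fun _ z => by positivity)]
  congr 1
  ext z
  rw [Finset.prod_mul_distrib, Finset.prod_const, Finset.card_univ, Fintype.card_fin,
    ← Finset.sum_neg_distrib, Real.exp_sum]

theorem sum_normSq_vecMul {n : ℕ} (W : Matrix (Fin n) (Fin n) ℂ) (hW : W * star W = 1)
    (z : Fin n → ℂ) :
    ∑ i, Complex.normSq (Matrix.vecMul z W i) = ∑ i, Complex.normSq (z i) := by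
  have h : ∀ v : Fin n → ℂ, ((∑ i, Complex.normSq (v i) : ℝ) : ℂ) = v ⬝ᵥ star v := by
    intro v
    simp [dotProduct, Complex.mul_conj]
  apply Complex.ofReal_injective
  rw [h, h, Matrix.star_vecMul, ← Matrix.dotProduct_mulVec, Matrix.mulVec_mulVec,
    ← Matrix.star_eq_conjTranspose, hW, Matrix.one_mulVec]

/-- The law of a vector of independent `CN(0,1)` entries is invariant under unitary maps. -/
theorem map_vecMul_rayleighLaw {n : ℕ} (W : Matrix (Fin n) (Fin n) ℂ) (hW : W * star W = 1) :
    (rayleighLaw n).map (fun z => Matrix.vecMul z W) = rayleighLaw n := by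
  have hW' : star W * W = 1 := mul_eq_one_comm.1 hW
  set Φ : (Fin n → ℂ) ≃ₗ[ℝ] (Fin n → ℂ) := LinearEquiv.ofLinearMap
    ((Matrix.vecMulLinear W).restrictScalars ℝ) ((Matrix.vecMulLinear (star W)).restrictScalars ℝ)
    (LinearMap.ext fun z => by simp [Matrix.vecMul_vecMul, hW'])
    (LinearMap.ext fun z => by simp [Matrix.vecMul_vecMul, hW])
    with hΦ
  have hΦa : ∀ z, Φ z = Matrix.vecMul z W := fun z => rfl
  have hdet : LinearMap.det (Φ : (Fin n → ℂ) →ₗ[ℝ] (Fin n → ℂ)) ≠ 0 := Φ.isUnit_det'.ne_zero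
  have hvol := Measure.map_linearMap_addHaar_eq_smul_addHaar
    (volume : Measure (Fin n → ℂ)) hdet
  set k := ENNReal.ofReal |(LinearMap.det (Φ : (Fin n → ℂ) →ₗ[ℝ] (Fin n → ℂ)))⁻¹| with hk
  have hΦm : Measurable fun z : Fin n → ℂ => Matrix.vecMul z W :=
    (LinearMap.continuous_of_finiteDimensional (Φ : (Fin n → ℂ) →ₗ[ℝ] (Fin n → ℂ))).measurable
  set ρ : (Fin n → ℂ) → ENNReal := fun z =>
    ENNReal.ofReal (Real.pi⁻¹ ^ n * Real.exp (-∑ i, Complex.normSq (z i))) with hρ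
  have hρm : Measurable ρ := by
    have : Measurable Complex.normSq := Complex.continuous_normSq.measurable
    fun_prop
  have key : (rayleighLaw n).map (fun z => Matrix.vecMul z W) = k • rayleighLaw n := by
    refine Measure.ext_of_lintegral _ fun f hf => ?_
    have hfm : Measurable fun z => f (Matrix.vecMul z W) := hf.comp hΦm
    rw [lintegral_map hf hΦm, lintegral_smul_measure, rayleighLaw_eq_withDensity,
      lintegral_withDensity_eq_lintegral_mul _ hρm hfm,
      lintegral_withDensity_eq_lintegral_mul _ hρm hf, ← lintegral_smul_measure, ← hvol]
    change _ = ∫⁻ z, (ρ * f) z ∂(volume.map fun z => Matrix.vecMul z W)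
    rw [lintegral_map (hρm.mul hf) hΦm]
    refine lintegral_congr fun z => ?_
    simp only [Pi.mul_apply, hρ, sum_normSq_vecMul W hW]
  have hp : IsProbabilityMeasure ((rayleighLaw n).map fun z => Matrix.vecMul z W) :=
    Measure.isProbabilityMeasure_map hΦm.aemeasurable
  -- The Jacobian need not be computed: both laws have total mass 1.
  have hk1 : k = 1 := by
    have h1 := hp.measure_univ
    rw [key] at h1
    simpa using h1
  rw [key, hk1, one_smul]

/-! ### Diagonalising the received power. -/

theorem measurable_rxPower {n : ℕ} (Q : Matrix (Fin n) (Fin n) ℂ) :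
    Measurable fun z => rxPower z Q := by
  refine Continuous.measurable ?_
  unfold rxPower dotProduct Matrix.mulVec dotProduct
  fun_prop

theorem exists_unitary_diagonalization {n : ℕ} {M : Matrix (Fin n) (Fin n) ℂ}
    (hM : M.IsHermitian) :
    ∃ (W : Matrix (Fin n) (Fin n) ℂ) (l : Fin n → ℝ), W * star W = 1 ∧
      M = W * Matrix.diagonal (fun i => (l i : ℂ)) * star W := by
  refine ⟨hM.eigenvectorUnitary.1, hM.eigenvalues, Unitary.coe_mul_star_self _, ?_⟩
  have := hM.spectral_theorem
  rw [Unitary.conjStarAlgAut_apply] at this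
  exact this

/-- In an eigenbasis of `c⁻¹ A - B`, the quadratic form is a linear combination of independent
exponential random variables. -/
theorem exists_map_rxPower_eq {n : ℕ} {A B : Matrix (Fin n) (Fin n) ℂ} (hA : A.PosSemidef)
    (hB : B.PosSemidef) {c : ℝ} (hc : 0 < c) :
    ∃ α β : Fin n → ℝ, (∀ i, 0 ≤ α i) ∧ (∀ i, 0 ≤ β i) ∧ ∑ i, α i = A.trace.re / c ∧
      ∑ i, β i = B.trace.re ∧
      (rayleighLaw n).map (fun z => rxPower z A / c - rxPower z B) =
        (expProduct n).map fun x => ∑ i, (α i - β i) * x i := by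
  set M : Matrix (Fin n) (Fin n) ℂ := ((c⁻¹ : ℝ) : ℂ) • A - B with hMdef
  have hM : M.IsHermitian := by
    refine Matrix.IsHermitian.sub ?_ hB.isHermitian
    have : IsSelfAdjoint (((c⁻¹ : ℝ) : ℂ)) := Complex.conj_ofReal _
    exact this.smul hA.isHermitian
  obtain ⟨W, l, hW, hspec⟩ := exists_unitary_diagonalization hM
  have hW' : star W * W = 1 := mul_eq_one_comm.1 hW
  have hdiag : star W * M * W = Matrix.diagonal (fun i => (l i : ℂ)) := by
    rw [hspec]
    calc star W * (W * Matrix.diagonal (fun i => (l i : ℂ)) * star W) * W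
        = (star W * W) * Matrix.diagonal (fun i => (l i : ℂ)) * (star W * W) := by
          simp only [mul_assoc]
      _ = _ := by rw [hW', one_mul, mul_one]
  have htr : ∀ X : Matrix (Fin n) (Fin n) ℂ, (star W * X * W).trace = X.trace := by
    intro X
    rw [Matrix.trace_mul_comm, ← mul_assoc, hW, one_mul]
  have hpsd : ∀ X : Matrix (Fin n) (Fin n) ℂ, X.PosSemidef → ∀ i, 0 ≤ ((star W * X * W) i i).re := by
    intro X hX i
    have := (hX.conjTranspose_mul_mul_same W).diag_nonneg (i := i)
    exact (Complex.le_def.1 this).1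
  -- These are diagonal entries in the eigenbasis of M, not eigenvalues of A and B, which need not
  -- commute. Positivity and traces survive the change of basis, and only the difference has to be
  -- diagonal.
  refine ⟨fun i => ((star W * A * W) i i).re / c, fun i => ((star W * B * W) i i).re,
    fun i => div_nonneg (hpsd A hA i) hc.le, fun i => hpsd B hB i, ?_, ?_, ?_⟩
  · rw [← Finset.sum_div, ← htr A, Matrix.trace, Complex.re_sum]; rfl
  · rw [← htr B, Matrix.trace, Complex.re_sum]; rfl
  have heig : ∀ i, ((star W * A * W) i i).re / c - ((star W * B * W) i i).re =
      l i := by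
    intro i
    have h1 := congrFun (congrFun hdiag i) i
    rw [Matrix.diagonal_apply_eq, hMdef, mul_sub, sub_mul, Matrix.mul_smul, Matrix.smul_mul] at h1
    have h2 := congrArg Complex.re h1
    simp only [Matrix.sub_apply, Matrix.smul_apply, smul_eq_mul, Complex.sub_re,
      Complex.re_ofReal_mul, Complex.ofReal_re] at h2
    rw [← h2]
    ring
  have hform : ∀ z, rxPower z A / c - rxPower z B =
      ∑ i, l i * Complex.normSq (Matrix.vecMul z W i) := by
    intro z
    have h1 : rxPower z A / c - rxPower z B = rxPower z M := by
      simp only [rxPower, hMdef, Matrix.sub_mulVec, Matrix.smul_mulVec, dotProduct_sub,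
        dotProduct_smul, smul_eq_mul, Complex.sub_re, Complex.re_ofReal_mul]
      ring
    have h2 : Matrix.mulVec (star W) (star z) = star (Matrix.vecMul z W) := by
      rw [Matrix.star_vecMul, Matrix.star_eq_conjTranspose]
    rw [h1, rxPower, hspec, ← Matrix.mulVec_mulVec, ← Matrix.mulVec_mulVec,
      Matrix.dotProduct_mulVec, h2, dotProduct, Complex.re_sum]
    refine Finset.sum_congr rfl fun i _ => ?_
    rw [Matrix.mulVec_diagonal, Pi.star_apply, mul_left_comm, Complex.star_def, Complex.mul_conj,
      ← Complex.ofReal_mul, Complex.ofReal_re]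
  simp only [heig, hform]
  have hm1 : Measurable fun x : Fin n → ℝ => ∑ i, l i * x i := by fun_prop
  have hm2 : Measurable fun (z : Fin n → ℂ) i => Complex.normSq (z i) := by
    have : Measurable Complex.normSq := Complex.continuous_normSq.measurable
    fun_prop
  have hm3 : Measurable fun z : Fin n → ℂ => Matrix.vecMul z W := by
    refine Continuous.measurable ?_
    unfold Matrix.vecMul dotProduct
    fun_prop
  rw [← map_normSq_rayleighLaw, Measure.map_map hm1 hm2]
  conv_rhs => rw [← map_vecMul_rayleighLaw W hW]
  rw [Measure.map_map (hm1.comp hm2) hm3]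
  rfl

/-! ### The bound for a single layer. -/

/-- The contribution of a layer with power `a`, interference power `b` and threshold `s`. -/
noncomputable def layerValue (n : ℕ) (a b s : ℝ) : ℝ :=
  erlangTail n (n * s) * Real.log (1 + a * s / (1 + b * s))

theorem layerValue_nonneg {n : ℕ} (hn : 1 ≤ n) {a b s : ℝ} (ha : 0 ≤ a) (hb : 0 ≤ b)
    (hs : 0 ≤ s) : 0 ≤ layerValue n a b s := by
  refine mul_nonneg (erlangTail_pos hn (by positivity)).le (Real.log_nonneg ?_)
  have : 0 ≤ a * s / (1 + b * s) := by positivity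
  linarith

theorem layerValue_mono {n : ℕ} (hn : 1 ≤ n) {a a' b s : ℝ} (ha : 0 ≤ a) (haa' : a ≤ a')
    (hb : 0 ≤ b) (hs : 0 ≤ s) : layerValue n a b s ≤ layerValue n a' b s := by
  have h1 : 0 ≤ a * s / (1 + b * s) := by positivity
  unfold layerValue
  refine mul_le_mul_of_nonneg_left (Real.log_le_log (by linarith) ?_)
    (erlangTail_pos hn (by positivity)).le
  gcongr

theorem rxPower_nonneg {n : ℕ} {Q : Matrix (Fin n) (Fin n) ℂ} (hQ : Q.PosSemidef)
    (z : Fin n → ℂ) : 0 ≤ rxPower z Q := by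
  have := hQ.re_dotProduct_nonneg (star z)
  rw [star_star] at this
  exact this

theorem trace_re_nonneg {n : ℕ} {Q : Matrix (Fin n) (Fin n) ℂ} (hQ : Q.PosSemidef) :
    0 ≤ Q.trace.re :=
  (Complex.le_def.1 hQ.trace_nonneg).1

/-- Tail bound for linear combinations of exponential random variables of both signs. -/
theorem exists_expProduct_real_ge_one_le {n : ℕ} (hn : 1 ≤ n) (α β : Fin n → ℝ)
    (hα : ∀ i, 0 ≤ α i) (hβ : ∀ i, 0 ≤ β i) :
    ∃ s, 0 < s ∧ s ≤ 1 ∧ (∑ i, α i) * s / (1 + (∑ i, β i) * s) ≤ 1 ∧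
      (expProduct n).real {x | 1 ≤ ∑ i, (α i - β i) * x i} ≤
        erlangTail n (n * s) * ((∑ i, α i) * s / (1 + (∑ i, β i) * s)) := by
  have hnb := integral_posPart_add_measure_le α β hα hβ
  set a := ∑ i, α i with ha_def
  set b := ∑ i, β i with hb_def
  have ha : 0 ≤ a := Finset.sum_nonneg fun i _ => hα i
  have hb : 0 ≤ b := Finset.sum_nonneg fun i _ => hβ i
  set p := (expProduct n).real {x | 0 < ∑ i, (α i - β i) * x i} with hp
  set e := ∫ x, max (∑ i, (α i - β i) * x i) 0 ∂expProduct n with he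
  have hp0 : 0 ≤ p := measureReal_nonneg
  have hp1 : p ≤ 1 := measureReal_le_one
  have he0 : 0 ≤ e := integral_nonneg fun x => le_max_right _ _
  have hn0 : (0 : ℝ) < n := by exact_mod_cast hn
  have htan : ∀ s, 0 < s → s ≤ 1 → n * s * erlangDensity n (n * s) ≤ erlangTail n (n * s) →
      (expProduct n).real {x | 1 ≤ ∑ i, (α i - β i) * x i} ≤
        (erlangTail n (n * s) - n * s * erlangDensity n (n * s)) * p +
          n * s * erlangDensity n (n * s) * (s * e) := by
    intro s hs0 hs1 hd
    have := expProduct_real_ge_one_le hn (fun i => α i - β i) (mul_pos hn0 hs0)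
      (mul_le_of_le_one_right hn0.le hs1) hd
    change _ ≤ _ * p + _ * e at this
    refine this.trans (le_of_eq ?_)
    field_simp
  have hd0 : ∀ s, 0 < s → 0 ≤ n * s * erlangDensity n (n * s) := fun s hs =>
    mul_nonneg (by positivity) (erlangDensity_nonneg n (by positivity))
  by_cases hP : (expProduct n).real {x | 1 ≤ ∑ i, (α i - β i) * x i} ≤ 0
  -- If the probability vanishes, any s in (0, 1] with as ≤ 1 + bs will do.
  · have hs : 0 < (a + 1)⁻¹ := by positivity
    refine ⟨(a + 1)⁻¹, hs, inv_le_one_of_one_le₀ (by linarith), ?_, hP.trans ?_⟩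
    · rw [div_le_one (by positivity)]
      have h1 : a * (a + 1)⁻¹ ≤ 1 := by
        rw [← div_eq_mul_inv, div_le_one (by positivity)]; linarith
      have : 0 ≤ b * (a + 1)⁻¹ := by positivity
      linarith
    · exact mul_nonneg (erlangTail_pos hn (by positivity)).le (by positivity)
  push Not at hP
  have hpp : 0 < p := hP.trans_le <| measureReal_mono fun x hx => by
    simp only [Set.mem_ofPred_eq] at hx ⊢
    linarith
  -- Otherwise e = 0, and the tangent through the origin bounds the probability by a multiple of e,
  -- contradicting its positivity.
  have hD : 0 < a - b * p := by
    by_contra hD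
    have he' : e = 0 := le_antisymm (by linarith) he0
    obtain ⟨s, hs0, hs1, -, hd, hor⟩ := exists_tangent_point hn one_pos
    have heq : n * s * erlangDensity n (n * s) = erlangTail n (n * s) := by
      rcases hor with rfl | h
      · refine le_antisymm hd ?_
        simpa using erlangTail_self_le hn
      · exact h
    have := htan s hs0 hs1 hd
    rw [heq, he', sub_self, zero_mul, mul_zero, mul_zero, add_zero] at this
    linarith
  -- At s = p/(a − bp) the ratio as/(1 + bs) equals p exactly; for smaller s it is at most p.
  obtain ⟨s, hs0, hs1, hss, hd, hor⟩ := exists_tangent_point hn (div_pos hpp hD)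
  have h1 : 0 < 1 + b * s := by positivity
  have hsD : s * (a - b * p) ≤ p := (le_div_iff₀ hD).1 hss
  have hq1 : a * s / (1 + b * s) ≤ p := by rw [div_le_iff₀ h1]; linarith
  have hse : s * e ≤ a * s / (1 + b * s) := by
    rw [le_div_iff₀ h1]
    have h2 : e * (1 + b * s) ≤ a := by
      have : e * (1 + b * s) ≤ (a - b * p) * (1 + b * s) :=
        mul_le_mul_of_nonneg_right (by linarith) h1.le
      nlinarith [mul_le_mul_of_nonneg_left hsD hb]
    nlinarith [mul_le_mul_of_nonneg_left h2 hs0.le]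
  refine ⟨s, hs0, hs1, hq1.trans hp1, (htan s hs0 hs1 hd).trans ?_⟩
  -- Either p equals the ratio, or the intercept of the tangent is zero; so p may be replaced by the
  -- ratio in both cases.
  have h3 : (erlangTail n (n * s) - n * s * erlangDensity n (n * s)) * p =
      (erlangTail n (n * s) - n * s * erlangDensity n (n * s)) *
        (a * s / (1 + b * s)) := by
    rcases hor with h | h
    · congr 1
      rw [eq_div_iff h1.ne']
      have : s * (a - b * p) = p := by rw [h]; exact div_mul_cancel₀ _ hD.ne'
      linarith
    · rw [h, sub_self, zero_mul, zero_mul]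
  rw [h3]
  nlinarith [mul_le_mul_of_nonneg_left hse (hd0 s hs0)]

/-- The expected rate of a single layer is at most the value of some threshold in `(0, 1]`. -/
theorem exists_layerValue_ge {n : ℕ} (hn : 1 ≤ n) {A B : Matrix (Fin n) (Fin n) ℂ}
    (hA : A.PosSemidef) (hB : B.PosSemidef) {R : ℝ} (hR : 0 ≤ R) :
    ∃ s, 0 < s ∧ s ≤ 1 ∧
      (rayleighLaw n).real {z | R ≤ Real.log (1 + rxPower z A / (1 + rxPower z B))} * R ≤
        layerValue n A.trace.re B.trace.re s := by
  have ha := trace_re_nonneg hA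
  have hb := trace_re_nonneg hB
  rcases hR.eq_or_lt with rfl | hR
  · exact ⟨1, one_pos, le_rfl, by rw [mul_zero]; exact layerValue_nonneg hn ha hb zero_le_one⟩
  set c := Real.exp R - 1 with hc
  have hc0 : 0 < c := by have := Real.add_one_lt_exp hR.ne'; linarith
  obtain ⟨α, β, hα, hβ, hαs, hβs, hmap⟩ := exists_map_rxPower_eq hA hB hc0
  obtain ⟨s, hs0, hs1, hq, hP⟩ := exists_expProduct_real_ge_one_le hn α β hα hβ
  refine ⟨s, hs0, hs1, ?_⟩
  have hset : {z | R ≤ Real.log (1 + rxPower z A / (1 + rxPower z B))} =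
      (fun z => rxPower z A / c - rxPower z B) ⁻¹' Set.Ici 1 := by
    ext z
    have hU := rxPower_nonneg hA z
    have hV := rxPower_nonneg hB z
    have h1 : 0 < 1 + rxPower z B := by linarith
    have h2 : 0 ≤ rxPower z A / (1 + rxPower z B) := by positivity
    simp only [Set.mem_ofPred_eq, Set.mem_preimage, Set.mem_Ici]
    rw [Real.le_log_iff_exp_le (by linarith), ← sub_le_iff_le_add', ← hc, le_div_iff₀ h1,
      le_sub_iff_add_le, le_div_iff₀ hc0, mul_comm]
  have hm1 : Measurable fun z : Fin n → ℂ => rxPower z A / c - rxPower z B :=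
    ((measurable_rxPower A).div_const c).sub (measurable_rxPower B)
  have hm2 : Measurable fun x : Fin n → ℝ => ∑ i, (α i - β i) * x i := by fun_prop
  have hPeq : (rayleighLaw n).real {z | R ≤ Real.log (1 + rxPower z A / (1 + rxPower z B))} =
      (expProduct n).real {x | 1 ≤ ∑ i, (α i - β i) * x i} := by
    rw [hset, measureReal_def, ← Measure.map_apply hm1 measurableSet_Ici, hmap,
      Measure.map_apply hm2 measurableSet_Ici]
    rfl
  rw [hPeq]
  rw [hαs, hβs] at hP hq
  set q := A.trace.re / c * s / (1 + B.trace.re * s) with hqdef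
  have hq0 : 0 ≤ q := by positivity
  have hT := (erlangTail_pos hn (x := n * s) (by positivity)).le
  -- Bernoulli's inequality with exponent q in [0, 1]: e^(qR) = (1 + c)^q ≤ 1 + qc, and qc no longer
  -- involves R.
  have hlog : q * R ≤ Real.log (1 + A.trace.re * s / (1 + B.trace.re * s)) := by
    have e1 : A.trace.re * s / (1 + B.trace.re * s) = q * c := by
      rw [hqdef]; field_simp
    have e2 : R = Real.log (1 + c) := by rw [hc, add_sub_cancel, Real.log_exp]
    rw [e1, e2, ← Real.log_rpow (by linarith)]
    exact Real.log_le_log (by positivity)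
      (rpow_one_add_le_one_add_mul_self (by linarith) hq0 hq)
  calc (expProduct n).real {x | 1 ≤ ∑ i, (α i - β i) * x i} * R
      ≤ erlangTail n (n * s) * q * R := mul_le_mul_of_nonneg_right hP hR.le
    _ = erlangTail n (n * s) * (q * R) := mul_assoc _ _ _
    _ ≤ _ := mul_le_mul_of_nonneg_left hlog hT

/-! ### The best threshold is interior. -/

/-- At s = 1 the logarithmic derivative of the tail factor is at most −1 by `erlangTail_self_le`,
while that of the logarithmic factor is below 1 because log y > 1 − 1/y for y > 1. -/
theorem layerValue_deriv_one_neg {n : ℕ} (hn : 1 ≤ n) {a b : ℝ} (ha : 0 < a) (hb : 0 ≤ b) :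
    ∃ f', f' < 0 ∧ HasDerivAt (layerValue n a b) f' 1 := by
  have h1b : 0 < 1 + b := by linarith
  have hq : 0 < a / (1 + b) := by positivity
  have hT : HasDerivAt (fun s : ℝ => erlangTail n (n * s)) (-erlangDensity n n * n) 1 := by
    have h0 : HasDerivAt (fun s : ℝ => (n : ℝ) * s) n 1 := by
      simpa using (hasDerivAt_id (1 : ℝ)).const_mul (n : ℝ)
    have := hasDerivAt_erlangTail hn ((n : ℝ) * 1)
    have := this.comp (1 : ℝ) h0
    rw [mul_one] at this
    exact this
  have hin : HasDerivAt (fun s : ℝ => 1 + a * s / (1 + b * s)) (a / (1 + b) ^ 2) 1 := by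
    have hnum : HasDerivAt (fun s : ℝ => a * s) a 1 := by
      simpa using (hasDerivAt_id (1 : ℝ)).const_mul a
    have hden : HasDerivAt (fun s : ℝ => 1 + b * s) b 1 := by
      simpa using ((hasDerivAt_id (1 : ℝ)).const_mul b).const_add 1
    have := (hnum.div hden (by simpa using h1b.ne')).const_add 1
    refine this.congr_deriv ?_
    simp only [mul_one]
    congr 1
    ring
  have hL := hin.log (by simp only [mul_one]; positivity)
  refine ⟨_, ?_, hT.mul hL⟩
  simp only [mul_one]
  set L := Real.log (1 + a / (1 + b)) with hLdef
  have hlog : a / (1 + b) ^ 2 / (1 + a / (1 + b)) < L := by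
    have h1 : 1 - (1 + a / (1 + b))⁻¹ < L := by
      have := Real.log_lt_sub_one_of_pos (x := (1 + a / (1 + b))⁻¹) (by positivity)
        (by rw [Ne, inv_eq_one]; linarith)
      rw [Real.log_inv] at this
      linarith
    refine lt_of_le_of_lt ?_ h1
    have e : 1 - (1 + a / (1 + b))⁻¹ = a / (1 + b) / (1 + a / (1 + b)) := by
      field_simp; ring
    rw [e]
    refine div_le_div_of_nonneg_right ?_ (by positivity)
    refine div_le_div_of_nonneg_left ha.le h1b ?_
    nlinarith
  have hTn := erlangTail_pos hn (x := n) (by positivity)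
  have hself := erlangTail_self_le hn
  have hL0 : 0 < L := Real.log_pos (by linarith)
  nlinarith [mul_lt_mul_of_pos_left hlog hTn, mul_le_mul_of_nonneg_right hself hL0.le]

theorem continuousOn_layerValue (n : ℕ) {a b : ℝ} (ha : 0 ≤ a) (hb : 0 ≤ b) :
    ContinuousOn (layerValue n a b) (Set.Ici 0) := by
  have h1 := continuous_erlangTail n
  unfold layerValue
  refine ContinuousOn.mul (by fun_prop) (ContinuousOn.log ?_ ?_)
  · refine continuousOn_const.add (ContinuousOn.div (by fun_prop) (by fun_prop) ?_)
    intro s hs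
    have : (0 : ℝ) ≤ s := hs
    positivity
  · intro s hs
    have : (0 : ℝ) ≤ s := hs
    positivity

/-- The best threshold of a layer lies in the open interval `(0, 1)`. -/
theorem exists_isMax_layerValue {n : ℕ} (hn : 1 ≤ n) {a b : ℝ} (ha : 0 ≤ a) (hb : 0 ≤ b) :
    ∃ s, 0 < s ∧ s < 1 ∧ ∀ t, 0 ≤ t → t ≤ 1 → layerValue n a b t ≤ layerValue n a b s := by
  rcases ha.eq_or_lt with rfl | ha'
  · exact ⟨1 / 2, by norm_num, by norm_num, fun t _ _ => by simp [layerValue]⟩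
  obtain ⟨s, hs, hmax⟩ := isCompact_Icc.exists_isMaxOn (Set.nonempty_Icc.2 (zero_le_one' ℝ))
    ((continuousOn_layerValue n ha hb).mono fun s hs => hs.1)
  refine ⟨s, hs.1.lt_of_ne ?_, hs.2.lt_of_ne ?_, fun t h0 h1 => hmax ⟨h0, h1⟩⟩
  · rintro rfl
    have h1 := hmax (⟨zero_le_one, le_rfl⟩ : (1 : ℝ) ∈ Set.Icc (0 : ℝ) 1)
    simp only [Set.mem_ofPred_eq] at h1
    have h0 : layerValue n a b 0 = 0 := by simp [layerValue]
    have : 0 < layerValue n a b 1 := by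
      refine mul_pos (erlangTail_pos hn (by positivity)) (Real.log_pos ?_)
      have : 0 < a * 1 / (1 + b * 1) := by positivity
      linarith
    linarith
  · rintro rfl
    obtain ⟨f', hf', hder⟩ := layerValue_deriv_one_neg hn ha' hb
    -- A negative derivative at 1 makes the value larger just to the left, so 1 cannot be a
    -- maximiser.
    have hslope := (hasDerivAt_iff_tendsto_slope.1 hder).eventually (gt_mem_nhds hf')
    have h2 : ∀ᶠ t in nhdsWithin (1 : ℝ) (Set.Iio 1), slope (layerValue n a b) 1 t < 0 :=
      hslope.filter_mono (nhdsWithin_mono _ fun t ht => ne_of_lt ht)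
    have h3 : ∀ᶠ t in nhdsWithin (1 : ℝ) (Set.Iio 1), t ∈ Set.Ioo (0 : ℝ) 1 :=
      Ioo_mem_nhdsLT one_pos
    obtain ⟨t, ht, htI⟩ := (h2.and h3).exists
    have h4 := hmax (⟨htI.1.le, htI.2.le⟩ : t ∈ Set.Icc (0 : ℝ) 1)
    simp only [Set.mem_ofPred_eq] at h4
    rw [slope_def_field] at ht
    exact absurd ht (not_lt.2 (div_nonneg_of_nonpos (by linarith) (by linarith [htI.2])))

/-! ### From single layers to the expected rate. -/

theorem IsRayleighChannel.hasLaw {Ω : Type*} [MeasurableSpace Ω] {μ : Measure Ω}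
    [IsProbabilityMeasure μ] {n : ℕ} {h : Ω → Fin n → ℂ} (hh : IsRayleighChannel μ h) :
    HasLaw h (rayleighLaw n) μ := by
  have hm : AEMeasurable h μ := aemeasurable_pi_lambda _ fun l => (hh.law l).aemeasurable
  refine ⟨hm, ?_⟩
  have h1 := (iIndepFun_iff_map_fun_eq_pi_map fun l => (hh.law l).aemeasurable).1 hh.indep
  simp only [fun l => (hh.law l).map_eq] at h1
  exact h1

theorem measurable_layerMutualInfo {n K : ℕ} (Q : Fin K → Matrix (Fin n) (Fin n) ℂ) (i : Fin K) :
    Measurable fun z => layerMutualInfo Q z i :=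
  Real.measurable_log.comp (measurable_const.add
    ((measurable_rxPower _).div (measurable_const.add (measurable_rxPower _))))

theorem measureReal_layerMutualInfo {Ω : Type*} [MeasurableSpace Ω] {μ : Measure Ω}
    [IsProbabilityMeasure μ] {n K : ℕ} {h : Ω → Fin n → ℂ} (hh : IsRayleighChannel μ h)
    (Q : Fin K → Matrix (Fin n) (Fin n) ℂ) (i : Fin K) (r : ℝ) :
    μ.real {ω | r ≤ layerMutualInfo Q (h ω) i} =
      (rayleighLaw n).real {z | r ≤ layerMutualInfo Q z i} :=
  hh.hasLaw.measureReal_eq (p := fun z => r ≤ layerMutualInfo Q z i)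
    (measurableSet_le measurable_const (measurable_layerMutualInfo Q i))

/-- The total value of the layers with powers `p` and thresholds `s`. -/
noncomputable def layeredValue {K : ℕ} (n : ℕ) (p s : Fin K → ℝ) : ℝ :=
  ∑ i, layerValue n (p i) (∑ j ∈ Finset.Ioi i, p j) (s i)

theorem layeredObjective_eq_layeredValue {n K : ℕ} (hn : 1 ≤ n) {p s : Fin K → ℝ}
    (hs : ∀ i, 0 ≤ s i) : layeredObjective n p s = layeredValue n p s := by
  unfold layeredObjective layeredValue layerValue
  refine Finset.sum_congr rfl fun i _ => ?_
  rw [upperIncompleteGamma_div_factorial hn (mul_nonneg (Nat.cast_nonneg n) (hs i)),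
    Finset.sum_mul]

theorem exists_expectedRate_le {Ω : Type*} [MeasurableSpace Ω] {μ : Measure Ω}
    [IsProbabilityMeasure μ] {n K : ℕ} (hn : 1 ≤ n) {h : Ω → Fin n → ℂ}
    (hh : IsRayleighChannel μ h) {Q : Fin K → Matrix (Fin n) (Fin n) ℂ}
    (hQ : ∀ i, (Q i).PosSemidef) {R : Fin K → ℝ} (hR : ∀ i, 0 ≤ R i) :
    ∃ s : Fin K → ℝ, (∀ i, 0 < s i ∧ s i ≤ 1) ∧
      expectedRate μ h Q R ≤ layeredValue n (fun i => (Q i).trace.re) s := by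
  have hsum : ∀ i, (∑ j ∈ Finset.Ioi i, Q j).PosSemidef := fun i =>
    Matrix.posSemidef_sum _ fun j _ => hQ j
  choose s hs0 hs1 hs using fun i => exists_layerValue_ge hn (hQ i) (hsum i) (hR i)
  refine ⟨s, fun i => ⟨hs0 i, hs1 i⟩, Finset.sum_le_sum fun i _ => ?_⟩
  rw [measureReal_layerMutualInfo hh]
  have := hs i
  rw [Matrix.trace_sum, Complex.re_sum] at this
  exact this

theorem rxPower_smul_one {n : ℕ} (z : Fin n → ℂ) (c : ℝ) :
    rxPower z ((c : ℂ) • (1 : Matrix (Fin n) (Fin n) ℂ)) = c * ∑ i, Complex.normSq (z i) := by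
  rw [rxPower, Matrix.smul_mulVec, Matrix.one_mulVec, dotProduct_smul, smul_eq_mul,
    Complex.re_ofReal_mul, dotProduct, Complex.re_sum]
  congr 1
  refine Finset.sum_congr rfl fun i _ => ?_
  rw [Pi.star_apply, Complex.star_def, Complex.mul_conj, Complex.ofReal_re]

theorem sum_equalPowerCov {n K : ℕ} (p : Fin K → ℝ) (S : Finset (Fin K)) :
    ∑ j ∈ S, equalPowerCov n p j =
      (((∑ j ∈ S, p j) / n : ℝ) : ℂ) • (1 : Matrix (Fin n) (Fin n) ℂ) := by
  simp only [equalPowerCov]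
  rw [← Finset.sum_smul, ← Complex.ofReal_sum, Finset.sum_div]

theorem equalPowerCov_posSemidef {n K : ℕ} {p : Fin K → ℝ} (hp : ∀ i, 0 ≤ p i) (i : Fin K) :
    (equalPowerCov n p i).PosSemidef := by
  refine Matrix.PosSemidef.one.smul ?_
  have := hp i
  exact Complex.zero_le_real.2 (by positivity)

theorem trace_equalPowerCov {n K : ℕ} (hn : 1 ≤ n) (p : Fin K → ℝ) (i : Fin K) :
    (equalPowerCov n p i).trace.re = p i := by
  have hn0 : (n : ℝ) ≠ 0 := by positivity
  rw [equalPowerCov, Matrix.trace_smul, Matrix.trace_one, Fintype.card_fin, smul_eq_mul,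
    Complex.re_ofReal_mul, Complex.natCast_re, div_mul_cancel₀ _ hn0]

theorem rayleighLaw_real_sum_normSq_ge {n : ℕ} (hn : 1 ≤ n) {x : ℝ} (hx : 0 ≤ x) :
    (rayleighLaw n).real {z | x ≤ ∑ i, Complex.normSq (z i)} = erlangTail n x := by
  have hm : Measurable fun (z : Fin n → ℂ) i => Complex.normSq (z i) := by
    have : Measurable Complex.normSq := Complex.continuous_normSq.measurable
    fun_prop
  have hms : MeasurableSet {y : Fin n → ℝ | x ≤ ∑ i, y i} :=
    measurableSet_le measurable_const (by fun_prop)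
  rw [← expProduct_real_sum_ge hn hx, ← map_normSq_rayleighLaw, measureReal_def, measureReal_def,
    Measure.map_apply hm hms]
  rfl

/-- The rate of a layer that is decoded exactly when the normalised channel gain is at
least `s`. -/
noncomputable def thresholdRate {K : ℕ} (p s : Fin K → ℝ) (i : Fin K) : ℝ :=
  Real.log (1 + p i * s i / (1 + (∑ j ∈ Finset.Ioi i, p j) * s i))

theorem thresholdRate_nonneg {K : ℕ} {p s : Fin K → ℝ} (hp : ∀ i, 0 ≤ p i) (hs : ∀ i, 0 < s i)
    (i : Fin K) : 0 ≤ thresholdRate p s i := by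
  have h1 := hp i
  have h2 := hs i
  have h3 : 0 ≤ ∑ j ∈ Finset.Ioi i, p j := Finset.sum_nonneg fun j _ => hp j
  refine Real.log_nonneg ?_
  have : 0 ≤ p i * s i / (1 + (∑ j ∈ Finset.Ioi i, p j) * s i) := by positivity
  linarith

/-- With isotropic covariances the mutual information of a layer of positive power increases with
the gain ∑ |hₗ|², so the threshold rate is met exactly when the gain is at least n sᵢ, an Erlang
tail event. -/
theorem expectedRate_equalPowerCov {Ω : Type*} [MeasurableSpace Ω] {μ : Measure Ω}
    [IsProbabilityMeasure μ] {n K : ℕ} (hn : 1 ≤ n) {h : Ω → Fin n → ℂ}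
    (hh : IsRayleighChannel μ h) {p s : Fin K → ℝ} (hp : ∀ i, 0 ≤ p i) (hs : ∀ i, 0 < s i) :
    expectedRate μ h (equalPowerCov n p) (thresholdRate p s) = layeredValue n p s := by
  refine Finset.sum_congr rfl fun i _ => ?_
  rw [measureReal_layerMutualInfo hh]
  have hs' := hs i
  have hn0 : (0 : ℝ) < n := by exact_mod_cast hn
  -- A layer without power is always decoded, not only above the threshold, but its rate is 0 and
  -- both terms vanish.
  rcases (hp i).eq_or_lt with h0 | hpi
  · simp [thresholdRate, layerValue, ← h0]
  unfold layerValue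
  change _ = _ * thresholdRate p s i
  congr 1
  rw [← rayleighLaw_real_sum_normSq_ge hn (by positivity)]
  congr 1
  ext z
  simp only [Set.mem_ofPred_eq]
  set b := ∑ j ∈ Finset.Ioi i, p j with hb
  have hb0 : 0 ≤ b := Finset.sum_nonneg fun j _ => hp j
  set r := ∑ l, Complex.normSq (z l) with hr
  have hr0 : 0 ≤ r := Finset.sum_nonneg fun l _ => Complex.normSq_nonneg _
  have e1 : layerMutualInfo (equalPowerCov n p) z i =
      Real.log (1 + p i / n * r / (1 + b / n * r)) := by
    rw [layerMutualInfo, sum_equalPowerCov, rxPower_smul_one, equalPowerCov, rxPower_smul_one]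
  rw [e1, thresholdRate, ← hb, Real.log_le_log_iff (by positivity) (by positivity),
    add_le_add_iff_left, div_le_div_iff₀ (by positivity) (by positivity)]
  have e2 : p i / n * r * (1 + b * s i) - p i * s i * (1 + b / n * r) =
      p i / n * (r - n * s i) := by field_simp; ring
  have hpn : 0 < p i / n := by positivity
  constructor
  · intro hle
    have : 0 ≤ p i / n * (r - n * s i) := by linarith
    linarith [nonneg_of_mul_nonneg_right this hpn]
  · intro hle
    have : 0 ≤ p i / n * (r - n * s i) := mul_nonneg hpn.le (by linarith)
    linarith

/-! ### Optimising thresholds and powers. -/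

/-- For fixed powers each threshold enters only its own summand, so the layers are optimised
separately. -/
theorem exists_isMax_layeredValue {n K : ℕ} (hn : 1 ≤ n) {p : Fin K → ℝ} (hp : ∀ i, 0 ≤ p i) :
    ∃ s : Fin K → ℝ, (∀ i, 0 < s i ∧ s i < 1) ∧
      ∀ t : Fin K → ℝ, (∀ i, 0 ≤ t i ∧ t i ≤ 1) → layeredValue n p t ≤ layeredValue n p s := by
  choose s h0 h1 hs using fun i => exists_isMax_layerValue hn (hp i)
    (Finset.sum_nonneg fun j (_ : j ∈ Finset.Ioi i) => hp j)
  exact ⟨s, fun i => ⟨h0 i, h1 i⟩, fun t ht =>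
    Finset.sum_le_sum fun i _ => hs i (t i) (ht i).1 (ht i).2⟩

theorem isCompact_isPowerAllocation {K : ℕ} (P : ℝ) :
    IsCompact {p : Fin K → ℝ | IsPowerAllocation P p} := by
  have hcl : IsClosed {p : Fin K → ℝ | IsPowerAllocation P p} := by
    have h1 : IsClosed {p : Fin K → ℝ | ∀ i, 0 ≤ p i} := by
      simp only [Set.ofPred_forall]
      exact isClosed_iInter fun i => isClosed_le continuous_const (continuous_apply i)
    have h2 : IsClosed {p : Fin K → ℝ | ∑ i, p i = P} :=
      isClosed_eq (by fun_prop) continuous_const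
    exact h1.inter h2
  refine (isCompact_Icc (a := (0 : Fin K → ℝ)) (b := fun _ => P)).of_isClosed_subset hcl ?_
  intro p hp
  refine ⟨fun i => hp.1 i, fun i => ?_⟩
  rw [← hp.2]
  exact Finset.single_le_sum (fun j _ => hp.1 j) (Finset.mem_univ i)

theorem continuousOn_layeredValue (n K : ℕ) :
    ContinuousOn (fun q : (Fin K → ℝ) × (Fin K → ℝ) => layeredValue n q.1 q.2)
      {q | (∀ i, 0 ≤ q.1 i) ∧ ∀ i, 0 ≤ q.2 i} := by
  have hT := continuous_erlangTail n
  unfold layeredValue layerValue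
  refine continuousOn_finsetSum _ fun i _ => ?_
  have hden : ∀ q : (Fin K → ℝ) × (Fin K → ℝ), q ∈ {q : (Fin K → ℝ) × (Fin K → ℝ) |
      (∀ i, 0 ≤ q.1 i) ∧ ∀ i, 0 ≤ q.2 i} → 0 < 1 + (∑ j ∈ Finset.Ioi i, q.1 j) * q.2 i := by
    intro q hq
    have h1 : 0 ≤ ∑ j ∈ Finset.Ioi i, q.1 j := Finset.sum_nonneg fun j _ => hq.1 j
    have h2 := hq.2 i
    positivity
  refine ContinuousOn.mul (by fun_prop) (ContinuousOn.log ?_ ?_)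
  · exact continuousOn_const.add (ContinuousOn.div (by fun_prop) (by fun_prop)
      fun q hq => (hden q hq).ne')
  · intro q hq
    have h1 := hden q hq
    have h2 := hq.1 i
    have h3 := hq.2 i
    positivity

/-- Thresholds range over the closed interval to have compactness; the open interval is recovered
afterwards at fixed powers. -/
theorem exists_isMax_layeredValue_powers {n K : ℕ} (hK : 1 ≤ K) {P : ℝ} (hP : 0 < P) :
    ∃ p s : Fin K → ℝ, IsPowerAllocation P p ∧ (∀ i, 0 ≤ s i ∧ s i ≤ 1) ∧
      ∀ p' s' : Fin K → ℝ, IsPowerAllocation P p' → (∀ i, 0 ≤ s' i ∧ s' i ≤ 1) →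
        layeredValue n p' s' ≤ layeredValue n p s := by
  have hcomp := (isCompact_isPowerAllocation (K := K) P).prod
    (isCompact_Icc (a := (0 : Fin K → ℝ)) (b := 1))
  have hne : ({p : Fin K → ℝ | IsPowerAllocation P p} ×ˢ
      Set.Icc (0 : Fin K → ℝ) 1).Nonempty := by
    refine ⟨(Pi.single ⟨0, hK⟩ P, 0), ⟨fun i => ?_, by simp⟩, le_rfl, zero_le_one⟩
    exact (Pi.single_nonneg.2 hP.le : (0 : Fin K → ℝ) ≤ _) i
  obtain ⟨⟨p, s⟩, ⟨hp, hs⟩, hmax⟩ := hcomp.exists_isMaxOn hne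
    ((continuousOn_layeredValue n K).mono fun q hq => ⟨hq.1.1, fun i => hq.2.1 i⟩)
  exact ⟨p, s, hp, fun i => ⟨hs.1 i, hs.2 i⟩, fun p' s' hp' hs' =>
    hmax (⟨hp', fun i => (hs' i).1, fun i => (hs' i).2⟩ :
      (p', s') ∈ {p : Fin K → ℝ | IsPowerAllocation P p} ×ˢ Set.Icc (0 : Fin K → ℝ) 1)⟩

/-- Unused power can be given to the lowest layer, which does not interfere with the others. -/
theorem exists_isPowerAllocation_layeredValue_ge {n K : ℕ} (hn : 1 ≤ n) (hK : 1 ≤ K) {P : ℝ}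
    {p s : Fin K → ℝ} (hp : ∀ i, 0 ≤ p i) (hsum : ∑ i, p i ≤ P) (hs : ∀ i, 0 ≤ s i) :
    ∃ p' : Fin K → ℝ, IsPowerAllocation P p' ∧ layeredValue n p s ≤ layeredValue n p' s := by
  classical
  set p' : Fin K → ℝ := p + Pi.single (⟨0, hK⟩ : Fin K) (P - ∑ i, p i) with hp'
  have hle : ∀ i, p i ≤ p' i := by
    intro i
    have : (0 : Fin K → ℝ) ≤ Pi.single (⟨0, hK⟩ : Fin K) (P - ∑ i, p i) :=
      Pi.single_nonneg.2 (by linarith)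
    have := this i
    simp only [Pi.zero_apply] at this
    simp only [hp', Pi.add_apply]
    linarith
  refine ⟨p', ⟨fun i => (hp i).trans (hle i), ?_⟩, Finset.sum_le_sum fun i _ => ?_⟩
  · simp [hp', Finset.sum_add_distrib]
  · have hb : ∑ j ∈ Finset.Ioi i, p' j = ∑ j ∈ Finset.Ioi i, p j := by
      refine Finset.sum_congr rfl fun j hj => ?_
      have hij : i < j := Finset.mem_Ioi.1 hj
      have hj0 : j ≠ ⟨0, hK⟩ := by
        rintro rfl
        exact absurd hij (by simp [Fin.lt_def])
      simp [hp', hj0]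
    rw [hb]
    exact layerValue_mono hn (hp i) (hle i) (Finset.sum_nonneg fun j _ => hp j) (hs i)

theorem mainTheorem2 {Ω : Type*} [MeasurableSpace Ω] (μ : Measure Ω) [IsProbabilityMeasure μ]
    (n K : ℕ) (hn : 1 ≤ n) (hK : 1 ≤ K) (P : ℝ) (hP : 0 < P)
    (h : Ω → Fin n → ℂ) (hh : IsRayleighChannel μ h) :
    -- for every power allocation, equal-power uncorrelated signalling in each layer is optimal
    (∀ p : Fin K → ℝ, IsPowerAllocation P p →
      ∃ R : Fin K → ℝ, (∀ i, 0 ≤ R i) ∧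
        IsGreatest (expectedRatesWithPowers μ h p) (expectedRate μ h (equalPowerCov n p) R)) ∧
    -- the overall maximum is attained with such covariances and is given by the formula
    (∃ p R : Fin K → ℝ, IsPowerAllocation P p ∧ (∀ i, 0 ≤ R i) ∧
      IsGreatest (achievableExpectedRates μ h K P) (expectedRate μ h (equalPowerCov n p) R) ∧
      IsGreatest (layeredObjectiveValues n K P) (expectedRate μ h (equalPowerCov n p) R)) := by

  constructor
  · intro p hp
    obtain ⟨s, hs, hmax⟩ := exists_isMax_layeredValue hn hp.1
    refine ⟨thresholdRate p s, thresholdRate_nonneg hp.1 fun i => (hs i).1, ?_, ?_⟩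
    · exact ⟨_, _, fun i => ⟨equalPowerCov_posSemidef hp.1 i, trace_equalPowerCov hn p i⟩,
        thresholdRate_nonneg hp.1 fun i => (hs i).1, rfl⟩
    · rintro v ⟨Q, R, hQ, hR, rfl⟩
      obtain ⟨t, ht, hle⟩ := exists_expectedRate_le hn hh (fun i => (hQ i).1) hR
      rw [expectedRate_equalPowerCov hn hh hp.1 fun i => (hs i).1]
      simp only [fun i => (hQ i).2] at hle
      exact hle.trans (hmax t fun i => ⟨(ht i).1.le, (ht i).2⟩)
  · obtain ⟨p, s₀, hp, hs₀, hmax₀⟩ := exists_isMax_layeredValue_powers (n := n) hK hP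
    -- Keeping the optimal powers and re-optimising the thresholds loses nothing and puts them
    -- strictly inside (0, 1).
    obtain ⟨s, hs, hmax⟩ := exists_isMax_layeredValue hn hp.1
    have hbest : ∀ p' s' : Fin K → ℝ, IsPowerAllocation P p' → (∀ i, 0 ≤ s' i ∧ s' i ≤ 1) →
        layeredValue n p' s' ≤ layeredValue n p s :=
      fun p' s' hp' hs' => (hmax₀ p' s' hp' hs').trans (hmax s₀ hs₀)
    have hR := thresholdRate_nonneg hp.1 fun i => (hs i).1
    refine ⟨p, thresholdRate p s, hp, hR, ⟨?_, ?_⟩, ⟨?_, ?_⟩⟩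
    · exact ⟨p, _, _, hp, fun i => ⟨equalPowerCov_posSemidef hp.1 i,
        (trace_equalPowerCov hn p i).le⟩, hR, rfl⟩
    · rintro v ⟨p', Q, R, hp', hQ, hR', rfl⟩
      obtain ⟨t, ht, hle⟩ := exists_expectedRate_le hn hh (fun i => (hQ i).1) hR'
      -- The traces may add up to less than P, so they need not form a power allocation; the surplus
      -- is assigned before comparing with the optimum.
      obtain ⟨p'', hp'', hle'⟩ := exists_isPowerAllocation_layeredValue_ge hn hK
        (fun i => trace_re_nonneg (hQ i).1)
        ((Finset.sum_le_sum fun i _ => (hQ i).2).trans hp'.2.le) fun i => (ht i).1.le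
      rw [expectedRate_equalPowerCov hn hh hp.1 fun i => (hs i).1]
      exact hle.trans (hle'.trans (hbest p'' t hp'' fun i => ⟨(ht i).1.le, (ht i).2⟩))
    · refine ⟨p, s, hp, hs, ?_⟩
      rw [expectedRate_equalPowerCov hn hh hp.1 fun i => (hs i).1,
        layeredObjective_eq_layeredValue hn fun i => (hs i).1.le]
    · rintro v ⟨p', s', hp', hs', rfl⟩
      rw [expectedRate_equalPowerCov hn hh hp.1 fun i => (hs i).1,
        layeredObjective_eq_layeredValue hn fun i => (hs' i).1.le]
      exact hbest p' s' hp' fun i => ⟨(hs' i).1.le, (hs' i).2.le⟩
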